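/- **Setting.** Let $\mathfrak X$ be a measurable Abelian group, i.e. a commutative group with a $\sigma$-algebra for which $(x,y)\mapsto x-y$ is measurable. Products and powers of finite signed measures on $\mathfrak X$ are convolutions (empty products being the Dirac measure at $0$), and $\|V\|=|V|(\mathfrak X)$ is the total variation norm. For $n\in\mathbb N=\{1,2,\dots\}$ and probability distributions $F_1,\dots,F_n,G$ on $\mathfrak X$ put $\overline F=\frac1n\sum_{j=1}^nF_j$ and, for $0\le\ell\le n$, $$V_k=\sum_{J\subseteq\{1,\dots,n\},\,|J|=k}\ \prod_{j\in J}(F_j-G),\qquad W_\ell=\sum_{k=0}^{\ell}V_k\,G^{n-k}.$$ For $1\le j,k\le n$ let $M_{j,k}=(F_j-G)\,G^{\lfloor (n-k)/k\rfloor}$, $\nu_{k,2}=\sum_{j=1}^n\|M_{j,k}\|^2$, $\widetilde\nu_k=\big\|\sum_{j=1}^nM_{j,k}\big\|$, and $$c_1=\sup_{x>0}\frac{\ln\big(2-(1-x)e^x\big)}{x^2},\qquad \eta_\ell=\max_{\ell<k\le n}\ \frac1k\Big(\frac{\widetilde\nu_k^2}{4c_1}+\nu_{k,2}\Big)\quad(\ell\in\{0,1\}),$$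 the maximum over the empty set being $0$. **Theorem.** (a) For every integer $\ell\ge0$ there is a smallest constant $u_\ell\in(0,\infty)$ such that, for all $\mathfrak X$, all $n\ge1$ with $n\ge\ell$ and all $F_1,\dots,F_n,G$, without any restriction on $\eta_0$, $$\Big\|\prod_{j=1}^nF_j-W_\ell\Big\|\le u_\ell\,\eta_0^{(\ell+1)/2}.$$ It satisfies $$u_\ell\le\frac{(2ec_1)^{(\ell+1)/2}}{1-x_\ell},$$ where $x_\ell\in(0,1)$ is the unique positive solution of $x^{\ell+1}+x/2=1$. Moreover $u_0\le5.9$, $u_1\le17.3$, $u_2\le44.5$ and $u_3\le107.5$. (b) For every integer $\ell\ge1$ there is a smallest constant $\widetilde u_\ell\in(0,\infty)$ such that, for all $\mathfrak X$, all $n\ge\ell$ and all $F_1,\dots,F_n,G$ with $G=\overline F$, without any restriction on $\eta_1$, $$\Big\|\prod_{j=1}^nF_j-W_\ell\Big\|\le\widetilde u_\ell\,\eta_1^{(\ell+1)/2}.$$ It satisfies $$\widetilde u_\ell\le\frac{(2ec_1)^{(\ell+1)/2}}{1-\widetilde x_\ell},$$ where $\widetilde x_\ell\in(0,1)$ is the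 unique positive solution of $x^{\ell+1}-x^2/2+x=1$. Moreover $\widetilde u_1\le10.94$, $\widetilde u_2\le31.5$ and $\widetilde u_3\le82.2$. (c) Let $n,d\in\mathbb N$, let $H_0,\dots,H_d$ be probability distributions on $\mathfrak X$, let $p_{j,r}\in[0,1]$ with $\sum_{r=0}^dp_{j,r}=1$ for $1\le j\le n$, let $\overline p_r=\frac1n\sum_{j=1}^np_{j,r}>0$ for $0\le r\le d$, and let $F_j=\sum_{r=0}^dp_{j,r}H_r$. Then $$\Big\|\prod_{j=1}^nF_j-\overline F^{\,n}\Big\|\le2\,\widetilde u_1\sum_{r=1}^d\sum_{j=1}^n\frac{(\overline p_r-p_{j,r})^2}{n\,\overline p_r\,\overline p_0}\le21.88\sum_{r=1}^d\sum_{j=1}^n\frac{(\overline p_r-p_{j,r})^2}{n\,\overline p_r\,\overline p_0}.$$ -/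

import Mathlib

open MeasureTheory

universe v

noncomputable section

namespace ConvCloseness

/-- In an additive group whose subtraction is jointly measurable, so is addition. -/
theorem measurableAdd₂_of_sub (X : Type*) [AddCommGroup X] [MeasurableSpace X]
    [MeasurableSub₂ X] : MeasurableAdd₂ X := by
  refine ⟨?_⟩
  have hneg : Measurable fun x : X => -x := by
    have h : Measurable fun x : X => (0 : X) - x := measurable_const.sub measurable_id
    simpa using h
  have h : Measurable fun p : X × X => p.1 - -p.2 :=
    measurable_fst.sub (hneg.comp measurable_snd)
  simpa using h

section Parts

variable {X : Type*} [MeasurableSpace X]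

/-- The positive part in the Hahn-Jordan decomposition. -/
abbrev posP (V : SignedMeasure X) : Measure X := V.toJordanDecomposition.posPart

/-- The negative part in the Hahn-Jordan decomposition. -/
abbrev negP (V : SignedMeasure X) : Measure X := V.toJordanDecomposition.negPart

theorem eq_pos_sub_neg (V : SignedMeasure X) :
    V = (posP V).toSignedMeasure - (negP V).toSignedMeasure :=
  (SignedMeasure.toSignedMeasure_toJordanDecomposition V).symm

end Parts

section Convolution

variable {X : Type*} [AddCommGroup X] [MeasurableSpace X]

/-- The convolution of two finite measures, as a finite signed measure. -/
def convPos (μ ν : Measure X) [IsFiniteMeasure μ] [IsFiniteMeasure ν] : SignedMeasure X :=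
  (μ.conv ν).toSignedMeasure

/-- The convolution of two finite signed measures: the bilinear extension of the convolution of
finite measures, evaluated through the Hahn-Jordan decompositions. -/
def conv (V W : SignedMeasure X) : SignedMeasure X :=
  convPos (posP V) (posP W) - convPos (posP V) (negP W)
    - convPos (negP V) (posP W) + convPos (negP V) (negP W)

theorem convPos_comm [MeasurableSub₂ X] (μ ν : Measure X) [IsFiniteMeasure μ]
    [IsFiniteMeasure ν] : convPos μ ν = convPos ν μ := by
  have := measurableAdd₂_of_sub X
  exact Measure.toSignedMeasure_congr (Measure.conv_comm μ ν)

theorem convPos_add_left [MeasurableSub₂ X] (μ μ' ν : Measure X) [IsFiniteMeasure μ]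
    [IsFiniteMeasure μ'] [IsFiniteMeasure ν] :
    convPos (μ + μ') ν = convPos μ ν + convPos μ' ν := by
  have := measurableAdd₂_of_sub X
  unfold convPos
  rw [← Measure.toSignedMeasure_add]
  exact Measure.toSignedMeasure_congr (Measure.add_conv μ μ' ν)

theorem convPos_congr_left {μ μ' : Measure X} [IsFiniteMeasure μ] [IsFiniteMeasure μ']
    (h : μ = μ') (ν : Measure X) [IsFiniteMeasure ν] : convPos μ ν = convPos μ' ν := by
  subst h; rfl

/-- If two differences of finite measures agree, so do their convolutions with `ν`. -/
theorem convPos_sub_congr [MeasurableSub₂ X] {μ μ' ρ ρ' : Measure X} [IsFiniteMeasure μ]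
    [IsFiniteMeasure μ'] [IsFiniteMeasure ρ] [IsFiniteMeasure ρ']
    (h : μ.toSignedMeasure - μ'.toSignedMeasure = ρ.toSignedMeasure - ρ'.toSignedMeasure)
    (ν : Measure X) [IsFiniteMeasure ν] :
    convPos μ ν - convPos μ' ν = convPos ρ ν - convPos ρ' ν := by
  have h1 : μ + ρ' = ρ + μ' := by
    rw [← Measure.toSignedMeasure_eq_toSignedMeasure_iff, Measure.toSignedMeasure_add,
      Measure.toSignedMeasure_add]
    exact sub_eq_sub_iff_add_eq_add.mp h
  rw [sub_eq_sub_iff_add_eq_add, ← convPos_add_left, ← convPos_add_left]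
  exact convPos_congr_left h1 ν

/-- The convolution may be computed from any representation as differences of measures. -/
theorem conv_sub_sub [MeasurableSub₂ X] (μ μ' ν ν' : Measure X) [IsFiniteMeasure μ]
    [IsFiniteMeasure μ'] [IsFiniteMeasure ν] [IsFiniteMeasure ν'] :
    conv (μ.toSignedMeasure - μ'.toSignedMeasure) (ν.toSignedMeasure - ν'.toSignedMeasure) =
      convPos μ ν - convPos μ ν' - convPos μ' ν + convPos μ' ν' := by
  unfold conv
  set V := μ.toSignedMeasure - μ'.toSignedMeasure with hV
  set W := ν.toSignedMeasure - ν'.toSignedMeasure with hW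
  have h1 := convPos_sub_congr ((eq_pos_sub_neg V).symm.trans hV) (posP W)
  have h2 := convPos_sub_congr ((eq_pos_sub_neg V).symm.trans hV) (negP W)
  have h3 := convPos_sub_congr ((eq_pos_sub_neg W).symm.trans hW) μ
  have h4 := convPos_sub_congr ((eq_pos_sub_neg W).symm.trans hW) μ'
  rw [convPos_comm _ μ, convPos_comm _ μ, convPos_comm _ μ, convPos_comm _ μ] at h3
  rw [convPos_comm _ μ', convPos_comm _ μ', convPos_comm _ μ', convPos_comm _ μ'] at h4
  calc _ = (convPos (posP V) (posP W) - convPos (negP V) (posP W))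
        - (convPos (posP V) (negP W) - convPos (negP V) (negP W)) := by abel
    _ = (convPos μ (posP W) - convPos μ (negP W))
        - (convPos μ' (posP W) - convPos μ' (negP W)) := by rw [h1, h2]; abel
    _ = _ := by rw [h3, h4]; abel

theorem conv_comm' [MeasurableSub₂ X] (V W : SignedMeasure X) : conv V W = conv W V := by
  unfold conv
  rw [convPos_comm (posP V) (posP W), convPos_comm (posP V) (negP W),
    convPos_comm (negP V) (posP W), convPos_comm (negP V) (negP W)]
  abel

theorem conv_add_left [MeasurableSub₂ X] (V V' W : SignedMeasure X) :
    conv (V + V') W = conv V W + conv V' W := by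
  have h : V + V' = (posP V + posP V').toSignedMeasure - (negP V + negP V').toSignedMeasure := by
    rw [Measure.toSignedMeasure_add, Measure.toSignedMeasure_add]
    conv_lhs => rw [eq_pos_sub_neg V, eq_pos_sub_neg V']
    abel
  conv_lhs => rw [h, eq_pos_sub_neg W, conv_sub_sub]
  unfold conv
  simp only [convPos_add_left]
  abel

theorem conv_assoc' [MeasurableSub₂ X] (U V W : SignedMeasure X) :
    conv (conv U V) W = conv U (conv V W) := by
  have := measurableAdd₂_of_sub X
  have key : ∀ A B : SignedMeasure X, conv A B =
      ((posP A).conv (posP B) + (negP A).conv (negP B)).toSignedMeasure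
        - ((posP A).conv (negP B) + (negP A).conv (posP B)).toSignedMeasure := by
    intro A B
    rw [Measure.toSignedMeasure_add, Measure.toSignedMeasure_add]
    unfold conv convPos
    abel
  have hassoc : ∀ (μ ν ρ : Measure X) [IsFiniteMeasure μ] [IsFiniteMeasure ν]
      [IsFiniteMeasure ρ], convPos μ (ν.conv ρ) = convPos (μ.conv ν) ρ := by
    intro μ ν ρ _ _ _
    exact Measure.toSignedMeasure_congr (Measure.conv_assoc μ ν ρ).symm
  have hr : ∀ (μ ν ρ : Measure X) [IsFiniteMeasure μ] [IsFiniteMeasure ν]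
      [IsFiniteMeasure ρ], convPos μ (ν + ρ) = convPos μ ν + convPos μ ρ := by
    intro μ ν ρ _ _ _
    rw [convPos_comm, convPos_add_left, convPos_comm ν, convPos_comm ρ]
  have e1 : conv (conv U V) W = conv (((posP U).conv (posP V)
      + (negP U).conv (negP V)).toSignedMeasure
        - ((posP U).conv (negP V) + (negP U).conv (posP V)).toSignedMeasure)
      ((posP W).toSignedMeasure - (negP W).toSignedMeasure) := by
    rw [← key, ← eq_pos_sub_neg]
  have e2 : conv U (conv V W) = conv ((posP U).toSignedMeasure - (negP U).toSignedMeasure)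
      (((posP V).conv (posP W) + (negP V).conv (negP W)).toSignedMeasure
        - ((posP V).conv (negP W) + (negP V).conv (posP W)).toSignedMeasure) := by
    rw [← key, ← eq_pos_sub_neg]
  rw [e1, e2, conv_sub_sub, conv_sub_sub]
  simp only [convPos_add_left, hr, hassoc]
  abel

theorem dirac_conv' [MeasurableSub₂ X] (V : SignedMeasure X) :
    conv (Measure.dirac (0 : X)).toSignedMeasure V = V := by
  have := measurableAdd₂_of_sub X
  have h0 : ∀ (ν : Measure X) [IsFiniteMeasure ν],
      convPos (Measure.dirac (0 : X)) ν = ν.toSignedMeasure := by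
    intro ν _
    exact Measure.toSignedMeasure_congr (Measure.dirac_zero_conv ν)
  have hz : ∀ (ν : Measure X) [IsFiniteMeasure ν], convPos (0 : Measure X) ν = 0 := by
    intro ν _
    unfold convPos
    rw [← Measure.toSignedMeasure_zero]
    exact Measure.toSignedMeasure_congr (Measure.zero_conv ν)
  have e : conv (Measure.dirac (0 : X)).toSignedMeasure V =
      conv ((Measure.dirac (0 : X)).toSignedMeasure - (0 : Measure X).toSignedMeasure)
        ((posP V).toSignedMeasure - (negP V).toSignedMeasure) := by
    rw [← eq_pos_sub_neg, Measure.toSignedMeasure_zero, sub_zero]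
  rw [e, conv_sub_sub, h0, h0, hz, hz]
  conv_rhs => rw [eq_pos_sub_neg V]
  abel

/-- Finite signed measures on a measurable Abelian group form a commutative ring: the
multiplication is the convolution and the unit is the Dirac measure at `0`. -/
instance instCommRingSignedMeasure [MeasurableSub₂ X] : CommRing (SignedMeasure X) :=
  { (inferInstance : AddCommGroup (SignedMeasure X)) with
    mul := conv
    one := (Measure.dirac (0 : X)).toSignedMeasure
    mul_assoc := conv_assoc'
    mul_comm := conv_comm'
    one_mul := dirac_conv'
    mul_one := fun V => (conv_comm' _ _).trans (dirac_conv' V)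
    left_distrib := fun U V W => by
      change conv U (V + W) = conv U V + conv U W
      rw [conv_comm', conv_add_left, conv_comm' V, conv_comm' W]
    right_distrib := conv_add_left
    zero_mul := fun V => by
      change conv 0 V = 0
      have h := conv_add_left 0 0 V
      rw [add_zero] at h
      exact left_eq_add.mp h
    mul_zero := fun V => by
      change conv V 0 = 0
      rw [conv_comm']
      have h := conv_add_left 0 0 V
      rw [add_zero] at h
      exact left_eq_add.mp h }

end Convolution

/-- The total variation norm `‖V‖ = |V|(X)` of a finite signed measure. -/
def tvNorm {X : Type*} [MeasurableSpace X] (V : SignedMeasure X) : ℝ :=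
  V.totalVariation.real Set.univ

/-- A probability distribution, regarded as a finite signed measure. -/
def sm {X : Type*} [MeasurableSpace X] (P : ProbabilityMeasure X) : SignedMeasure X :=
  (P : Measure X).toSignedMeasure

/-- `c₁ = sup_{x > 0} log (2 - (1 - x) e^x) / x²`. -/
def c₁ : ℝ :=
  sSup ((fun x : ℝ => Real.log (2 - (1 - x) * Real.exp x) / x ^ 2) '' Set.Ioi 0)

section Expansion

variable {X : Type*} [AddCommGroup X] [MeasurableSpace X] [MeasurableSub₂ X] {n : ℕ}

/-- The arithmetic mean `F̄ = n⁻¹ ∑ F_j`. -/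
def meanF (F : Fin n → ProbabilityMeasure X) : SignedMeasure X :=
  (n : ℝ)⁻¹ • ∑ j, sm (F j)

/-- `V_k = ∑_{|J| = k} ∏_{j ∈ J} (F_j - G)`, products in the convolution sense. -/
def Vk (F : Fin n → ProbabilityMeasure X) (G : ProbabilityMeasure X) (k : ℕ) :
    SignedMeasure X :=
  ∑ J ∈ (Finset.univ : Finset (Fin n)).powersetCard k, ∏ j ∈ J, (sm (F j) - sm G)

/-- `W_ℓ = ∑_{k=0}^ℓ V_k G^{n-k}` (used for `ℓ ≤ n`). -/
def Wl (F : Fin n → ProbabilityMeasure X) (G : ProbabilityMeasure X) (l : ℕ) :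
    SignedMeasure X :=
  ∑ k ∈ Finset.range (l + 1), Vk F G k * sm G ^ (n - k)

/-- `M_{j,k} = (F_j - G) G^⌊(n-k)/k⌋` (used for `1 ≤ k ≤ n`). -/
def Mjk (F : Fin n → ProbabilityMeasure X) (G : ProbabilityMeasure X) (j : Fin n) (k : ℕ) :
    SignedMeasure X :=
  (sm (F j) - sm G) * sm G ^ ((n - k) / k)

/-- `ν_{k,m} = ∑_j ‖M_{j,k}‖^m`. -/
def nu (F : Fin n → ProbabilityMeasure X) (G : ProbabilityMeasure X) (k m : ℕ) : ℝ :=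
  ∑ j, tvNorm (Mjk F G j k) ^ m

/-- `ν̃_k = ‖∑_j M_{j,k}‖`. -/
def nuTilde (F : Fin n → ProbabilityMeasure X) (G : ProbabilityMeasure X) (k : ℕ) : ℝ :=
  tvNorm (∑ j, Mjk F G j k)

/-- `η_ℓ = max_{ℓ < k ≤ n} k⁻¹ (ν̃_k² / (4 c₁) + ν_{k,2})`. The supremum is over a finite set, so
it is the maximum; for `ℓ = n` the set is empty and the value is `0`. -/
def eta (F : Fin n → ProbabilityMeasure X) (G : ProbabilityMeasure X) (l : ℕ) : ℝ :=
  sSup ((fun k : ℕ => (1 / (k : ℝ)) * (nuTilde F G k ^ 2 / (4 * c₁) + nu F G k 2)) ''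
    (Finset.Icc (l + 1) n : Set ℕ))

end Expansion

/-- The constants `u ∈ (0,∞)` with `‖∏ F_j - W_ℓ‖ ≤ u η₀^{(ℓ+1)/2}` for all measurable Abelian
groups, all `n ≥ 1` with `ℓ ≤ n` and all probability distributions `F_1, …, F_n, G`. -/
def admissible (l : ℕ) : Set ℝ :=
  {u | 0 < u ∧ ∀ (X : Type v) [AddCommGroup X] [MeasurableSpace X] [MeasurableSub₂ X] (n : ℕ),
    1 ≤ n → l ≤ n → ∀ (F : Fin n → ProbabilityMeasure X) (G : ProbabilityMeasure X),
      tvNorm ((∏ j, sm (F j)) - Wl F G l) ≤ u * eta F G 0 ^ (((l : ℝ) + 1) / 2)}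

/-- The smallest constant in the bound in terms of `η₀`. -/
def uConst (l : ℕ) : ℝ := sInf (admissible.{v} l)

/-- The constants `u ∈ (0,∞)` with `‖∏ F_j - W_ℓ‖ ≤ u η₁^{(ℓ+1)/2}` for all measurable Abelian
groups, all `n ≥ 1` with `ℓ ≤ n` and all probability distributions `F_1, …, F_n, G` such that
`G = F̄`. -/
def admissibleMean (l : ℕ) : Set ℝ :=
  {u | 0 < u ∧ ∀ (X : Type v) [AddCommGroup X] [MeasurableSpace X] [MeasurableSub₂ X] (n : ℕ),
    1 ≤ n → l ≤ n → ∀ (F : Fin n → ProbabilityMeasure X) (G : ProbabilityMeasure X),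
      sm G = meanF F →
      tvNorm ((∏ j, sm (F j)) - Wl F G l) ≤ u * eta F G 1 ^ (((l : ℝ) + 1) / 2)}

/-- The smallest constant in the bound in terms of `η₁` for `G = F̄`. -/
def uTilde (l : ℕ) : ℝ := sInf (admissibleMean.{v} l)

end ConvCloseness

end

noncomputable section

namespace ConvCloseness

/-! ### The total variation norm as a seminorm on finite signed measures. -/

section TotalVariation

variable {X : Type*} [MeasurableSpace X]

/-! Writing `F_j = (F_j - G) + G` and expanding the product gives `∏ F_j = ∑_k V_k G^(n-k)`, so the
error is the part of this sum with `k > ℓ`. Spreading the power of `G` evenly over the `k` factors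
turns `V_k G^(n-k)` into the `k`-th elementary symmetric function of the `M_{j,k}`, times a leftover
power of `G` of norm at most one (`esymm_mul_pow`).

That symmetric function is the coefficient of `z^k` in `∏ (1 + M_j z) = exp(z ∑ M_j) ∏ (1 + M_j z)
exp(-M_j z)`. In norm it is majorized by the coefficient of `exp(ν̃ z) ∏ g(‖M_j‖ z)`, where `g(x) =
2 - (1 - x) e^x` has no linear term (`majorizes_prod_one_add`). With `a^i / i! ≤ exp(a²/4)`, `g(x) ≤
exp(c₁ x²)` and the best radius in a Cauchy estimate, every term is at most `y^k` with `y = √(2 e c₁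
η)` (`seminorm_esymm_le`).

No smallness of `η` is needed: for small `y` sum the geometric tail, for large `y` use that the
product and the `k = 0` term have norm at most one. The two bounds meet at the root of the stated
equation (`le_pow_div_of_head_of_tail`). If `G` is the mean, then `V_1 = 0` and `ν̃_k = 0`, so the
coefficients of `∏ g(‖M_j‖ z)` can be computed exactly for `k ≤ 7`, which yields the sharper
numerical constants.

The infimum of the admissible constants is admissible because the inequality is closed in `u`; it is
positive because of an example on a group of order two. The multinomial bound follows from the case
`ℓ = 1` once `η₁` is bounded, and this is a variance estimate: the derivative of `g^N` in a centred
direction has, relative to `g^N`, a density whose variance grows only linearly in `N`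
(`seminorm_mul_pow_sq_le`). -/

theorem tvNorm_eq_add (V : SignedMeasure X) :
    tvNorm V = (posP V).real Set.univ + (negP V).real Set.univ := by
  unfold tvNorm SignedMeasure.totalVariation
  exact measureReal_add_apply

theorem tvNorm_nonneg (V : SignedMeasure X) : 0 ≤ tvNorm V := measureReal_nonneg

/-- The Jordan decomposition has the least total mass among all differences of measures. -/
theorem tvNorm_sub_le (μ ν : Measure X) [IsFiniteMeasure μ] [IsFiniteMeasure ν] :
    tvNorm (μ.toSignedMeasure - ν.toSignedMeasure) ≤ μ.real Set.univ + ν.real Set.univ := by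
  set V := μ.toSignedMeasure - ν.toSignedMeasure with hV
  obtain ⟨S, hS, hp, hn⟩ := V.toJordanDecomposition.mutuallySingular
  have hV' : ∀ A, MeasurableSet A → (posP V).real A - (negP V).real A = μ.real A - ν.real A := by
    intro A hA
    rw [← Measure.toSignedMeasure_sub_apply hA, ← eq_pos_sub_neg, hV,
      Measure.toSignedMeasure_sub_apply hA]
  have h1 := hV' S hS
  have h2 := hV' Sᶜ hS.compl
  have e1 : (posP V).real S = 0 := by simp [measureReal_def, posP, hp]
  have e2 : (negP V).real Sᶜ = 0 := by simp [measureReal_def, negP, hn]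
  rw [tvNorm_eq_add, ← measureReal_add_measureReal_compl hS, ← measureReal_add_measureReal_compl hS,
    ← measureReal_add_measureReal_compl (μ := μ) hS,
    ← measureReal_add_measureReal_compl (μ := ν) hS]
  have p1 : 0 ≤ μ.real S := measureReal_nonneg
  have p2 : 0 ≤ ν.real Sᶜ := measureReal_nonneg
  linarith

theorem tvNorm_zero : tvNorm (0 : SignedMeasure X) = 0 := by
  simp [tvNorm, SignedMeasure.totalVariation_zero]

theorem tvNorm_add_le (V W : SignedMeasure X) : tvNorm (V + W) ≤ tvNorm V + tvNorm W := by
  have h : V + W = (posP V + posP W).toSignedMeasure - (negP V + negP W).toSignedMeasure := by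
    rw [Measure.toSignedMeasure_add, Measure.toSignedMeasure_add]
    conv_lhs => rw [eq_pos_sub_neg V, eq_pos_sub_neg W]
    abel
  rw [h]
  refine (tvNorm_sub_le _ _).trans (le_of_eq ?_)
  rw [tvNorm_eq_add, tvNorm_eq_add, measureReal_add_apply, measureReal_add_apply]
  ring

theorem smul_eq_pos_sub_neg (c : NNReal) (V : SignedMeasure X) :
    (c : ℝ) • V = (c • posP V).toSignedMeasure - (c • negP V).toSignedMeasure := by
  rw [Measure.toSignedMeasure_smul, Measure.toSignedMeasure_smul]
  conv_lhs => rw [eq_pos_sub_neg V]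
  exact smul_sub _ _ _

theorem tvNorm_smul_le (c : ℝ) (V : SignedMeasure X) : tvNorm (c • V) ≤ ‖c‖ * tvNorm V := by
  have key : ∀ (c : NNReal) (V : SignedMeasure X), tvNorm ((c : ℝ) • V) ≤ c * tvNorm V := by
    intro c V
    rw [smul_eq_pos_sub_neg]
    refine (tvNorm_sub_le _ _).trans (le_of_eq ?_)
    rw [tvNorm_eq_add, mul_add]
    simp [measureReal_def]
  rcases le_total 0 c with h | h
  · have := key ⟨c, h⟩ V
    rwa [Real.norm_of_nonneg h]
  · have := key ⟨-c, neg_nonneg.2 h⟩ V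
    rw [Real.norm_of_nonpos h]
    have e : c • V = -((-c) • V) := by ext A _; simp
    rw [e]
    unfold tvNorm at this ⊢
    rwa [SignedMeasure.totalVariation_neg]

/-- The total variation norm as a seminorm. -/
def tvSeminorm (X : Type*) [MeasurableSpace X] : Seminorm ℝ (SignedMeasure X) :=
  Seminorm.ofSMulLE tvNorm tvNorm_zero tvNorm_add_le tvNorm_smul_le

/-- Definiteness is used only to show that the optimal constants are positive. -/
theorem eq_zero_of_tvNorm_eq_zero {V : SignedMeasure X} (h : tvNorm V = 0) : V = 0 := by
  have h0 : V.totalVariation Set.univ = 0 := by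
    have : IsFiniteMeasure V.totalVariation := by
      unfold SignedMeasure.totalVariation; infer_instance
    exact (measureReal_eq_zero_iff).1 h
  ext A hA
  rw [zero_apply]
  exact SignedMeasure.null_of_totalVariation_zero V (measure_mono_null (Set.subset_univ A) h0)

theorem tvNorm_sm (P : ProbabilityMeasure X) : tvNorm (sm P) ≤ 1 := by
  have := tvNorm_sub_le (P : Measure X) 0
  simpa [sm] using this

end TotalVariation

/-! ### Submultiplicativity, and the real algebra structure under convolution. -/

section Algebra

variable {X : Type*} [AddCommGroup X] [MeasurableSpace X] [MeasurableSub₂ X]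

theorem real_univ_conv (μ ν : Measure X) [IsFiniteMeasure μ] [IsFiniteMeasure ν] :
    (μ.conv ν).real Set.univ = μ.real Set.univ * ν.real Set.univ := by
  have := measurableAdd₂_of_sub X
  have hm : Measurable fun p : X × X => p.1 + p.2 := measurable_add
  rw [measureReal_def, Measure.conv, Measure.map_apply hm MeasurableSet.univ, Set.preimage_univ,
    ← Set.univ_prod_univ, Measure.prod_prod, ENNReal.toReal_mul]
  rfl

theorem conv_eq_sub (A B : SignedMeasure X) : conv A B =
    ((posP A).conv (posP B) + (negP A).conv (negP B)).toSignedMeasure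
      - ((posP A).conv (negP B) + (negP A).conv (posP B)).toSignedMeasure := by
  rw [Measure.toSignedMeasure_add, Measure.toSignedMeasure_add]
  unfold conv convPos
  abel

/-- Multiplying out the Jordan parts represents the convolution as a difference of measures with
total mass `‖V‖ ‖W‖`, and no representation has less mass than the Jordan decomposition. -/
theorem tvNorm_mul_le (V W : SignedMeasure X) : tvNorm (V * W) ≤ tvNorm V * tvNorm W := by
  change tvNorm (conv V W) ≤ _
  rw [conv_eq_sub]
  refine (tvNorm_sub_le _ _).trans (le_of_eq ?_)
  rw [tvNorm_eq_add, tvNorm_eq_add, measureReal_add_apply, measureReal_add_apply]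
  simp only [real_univ_conv]
  ring

theorem tvNorm_one_le : tvNorm (1 : SignedMeasure X) ≤ 1 := by
  have := tvNorm_sub_le (Measure.dirac (0 : X)) 0
  change tvNorm (Measure.dirac (0 : X)).toSignedMeasure ≤ 1
  simpa using this

theorem convPos_smul_left (c : NNReal) (μ ν : Measure X) [IsFiniteMeasure μ] [IsFiniteMeasure ν] :
    convPos (c • μ) ν = (c : ℝ) • convPos μ ν := by
  have := measurableAdd₂_of_sub X
  unfold convPos
  have h : (c • μ).conv ν = c • (μ.conv ν) := by
    unfold Measure.conv
    rw [Measure.prod_smul_left, Measure.map_smul]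
  exact (Measure.toSignedMeasure_congr h).trans (Measure.toSignedMeasure_smul _ c)

theorem smul_mul_signedMeasure (c : ℝ) (V W : SignedMeasure X) : (c • V) * W = c • (V * W) := by
  have key : ∀ (c : NNReal) (V W : SignedMeasure X), ((c : ℝ) • V) * W = (c : ℝ) • (V * W) := by
    intro c V W
    change conv _ _ = _ • conv _ _
    conv_lhs => rw [smul_eq_pos_sub_neg, eq_pos_sub_neg W, conv_sub_sub]
    unfold conv
    simp only [convPos_smul_left, smul_sub, smul_add]
  rcases le_total 0 c with h | h
  · exact key ⟨c, h⟩ V W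
  · have := key ⟨-c, neg_nonneg.2 h⟩ V W
    have e : ∀ U : SignedMeasure X, c • U = -((-c) • U) := by intro U; ext A _; simp
    rw [e V, e (V * W), neg_mul]
    exact congrArg _ this

instance instAlgebraSignedMeasure : Algebra ℝ (SignedMeasure X) :=
  Algebra.ofModule smul_mul_signedMeasure fun c V W => by
    rw [mul_comm, smul_mul_signedMeasure, mul_comm]

end Algebra

/-! ### Coefficientwise majorants for power series over a seminormed algebra. -/

section PowerSeriesMajorants

open PowerSeries Finset

variable {R : Type*} [CommRing R] [Algebra ℝ R]

/-- The power series `exp (A z)`. -/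
def expSeries (A : R) : R⟦X⟧ := PowerSeries.mk fun k => ((k.factorial : ℝ)⁻¹) • A ^ k

theorem coeff_expSeries (A : R) (k : ℕ) :
    coeff k (expSeries A) = ((k.factorial : ℝ)⁻¹) • A ^ k := coeff_mk _ _

theorem expSeries_zero : expSeries (0 : R) = 1 := by
  ext k
  rw [coeff_expSeries, coeff_one]
  rcases k with _ | k <;> simp

theorem expSeries_add (A B : R) : expSeries (A + B) = expSeries A * expSeries B := by
  ext k
  rw [coeff_mul, coeff_expSeries, (Commute.all A B).add_pow', Finset.smul_sum]
  refine Finset.sum_congr rfl fun ij hij => ?_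
  rw [coeff_expSeries, coeff_expSeries, smul_mul_smul_comm, ← Nat.cast_smul_eq_nsmul ℝ, smul_smul]
  congr 1
  have hk : ij.1 + ij.2 = k := HasAntidiagonal.mem_antidiagonal.1 hij
  have h := Nat.choose_mul_factorial_mul_factorial (Nat.le.intro hk)
  rw [← hk, Nat.add_sub_cancel_left, hk] at h
  have h' : (k.choose ij.1 : ℝ) * ij.1.factorial * ij.2.factorial = k.factorial := by
    exact_mod_cast h
  have h1 : (ij.1.factorial : ℝ) ≠ 0 := by exact_mod_cast ij.1.factorial_ne_zero
  have h2 : (ij.2.factorial : ℝ) ≠ 0 := by exact_mod_cast ij.2.factorial_ne_zero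
  have h3 : (k.factorial : ℝ) ≠ 0 := by exact_mod_cast k.factorial_ne_zero
  field_simp
  linarith

theorem expSeries_sum {ι : Type*} (s : Finset ι) (M : ι → R) :
    expSeries (∑ j ∈ s, M j) = ∏ j ∈ s, expSeries (M j) := by
  classical
  induction s using Finset.induction_on with
  | empty => simp [expSeries_zero]
  | insert a s ha ih => rw [sum_insert ha, prod_insert ha, expSeries_add, ih]

/-- The elementary symmetric functions are the coefficients of `∏ (1 + M_j z)`. -/
theorem coeff_prod_one_add {R ι : Type*} [CommRing R] (s : Finset ι) (M : ι → R) (k : ℕ) :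
    coeff k (∏ j ∈ s, (1 + C (M j) * X)) = ∑ J ∈ s.powersetCard k, ∏ j ∈ J, M j := by
  classical
  rw [Finset.prod_one_add, map_sum, ← Finset.sum_filter_add_sum_filter_not _ fun J => J.card = k]
  have h1 : ∀ J : Finset ι, coeff k (∏ j ∈ J, (C (M j) * X)) =
      if J.card = k then ∏ j ∈ J, M j else 0 := by
    intro J
    rw [prod_mul_distrib, prod_const, ← map_prod, coeff_C_mul, coeff_X_pow]
    by_cases h : J.card = k
    · simp [h]
    · rw [if_neg h, if_neg (Ne.symm h), mul_zero]
  rw [Finset.sum_congr rfl fun J _ => h1 J, Finset.sum_congr (s₁ := filter _ _) rfl fun J _ => h1 J]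
  rw [Finset.sum_ite_of_true (fun J hJ => (mem_filter.1 hJ).2),
    Finset.sum_ite_of_false (fun J hJ => (mem_filter.1 hJ).2), sum_const_zero, add_zero]
  rw [Finset.powersetCard_eq_filter]

/-- The coefficients of `(1 + x) e^(-x)` combine as `1/k! - 1/(k+1)! = k/(k+1)!` up to sign. The
linear one vanishes, and the absolute values are those of `gSeries`. -/
theorem coeff_one_add_mul_expSeries_neg (M : R) (k : ℕ) :
    coeff (k + 1) ((1 + C M * X) * expSeries (-M)) =
      (((-1) ^ k * (k / (k + 1).factorial : ℝ)) : ℝ) • M ^ (k + 1) := by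
  rw [add_mul, one_mul, map_add, mul_assoc, coeff_C_mul, coeff_succ_X_mul, coeff_expSeries,
    coeff_expSeries, mul_smul_comm, neg_pow M, neg_pow M]
  have e1 : (-1 : R) ^ (k + 1) * M ^ (k + 1) = ((-1 : ℝ) ^ (k + 1)) • M ^ (k + 1) := by
    rw [Algebra.smul_def, map_pow, map_neg, map_one]
  have e2 : M * ((-1 : R) ^ k * M ^ k) = ((-1 : ℝ) ^ k) • M ^ (k + 1) := by
    rw [Algebra.smul_def, map_pow, map_neg, map_one]; ring
  rw [e1, e2, smul_smul, smul_smul, ← add_smul]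
  congr 1
  have h3 : (k.factorial : ℝ) ≠ 0 := by exact_mod_cast k.factorial_ne_zero
  rw [Nat.factorial_succ]
  push_cast
  field_simp
  ring

/-- The power series of `2 - (1 - m z) exp (m z)`. -/
def gSeries (m : ℝ) : ℝ⟦X⟧ :=
  PowerSeries.mk fun k => (if k = 0 then 1 else ((k : ℝ) - 1) / k.factorial) * m ^ k

theorem coeff_gSeries_zero (m : ℝ) : coeff 0 (gSeries m) = 1 := by simp [gSeries]

theorem coeff_gSeries_succ (m : ℝ) (k : ℕ) :
    coeff (k + 1) (gSeries m) = (k / (k + 1).factorial : ℝ) * m ^ (k + 1) := by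
  simp [gSeries]

theorem coeff_gSeries_nonneg {m : ℝ} (hm : 0 ≤ m) (k : ℕ) : 0 ≤ coeff k (gSeries m) := by
  rcases k with _ | k
  · rw [coeff_gSeries_zero]; exact zero_le_one
  · rw [coeff_gSeries_succ]; positivity

variable (p : Seminorm ℝ R)

/-- The real power series `g` dominates `f` coefficientwise in the seminorm `p`. -/
def Majorizes (f : R⟦X⟧) (g : ℝ⟦X⟧) : Prop := ∀ k, p (coeff k f) ≤ coeff k g

variable {p}

theorem seminorm_sum_le {ι : Type*} (s : Finset ι) (f : ι → R) :
    p (∑ i ∈ s, f i) ≤ ∑ i ∈ s, p (f i) := by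
  classical
  induction s using Finset.induction_on with
  | empty => simp
  | insert a s ha ih =>
    rw [sum_insert ha, sum_insert ha]
    exact (map_add_le_add p _ _).trans (by gcongr)

theorem Majorizes.mul (hmul : ∀ a b, p (a * b) ≤ p a * p b) {f f' : R⟦X⟧} {g g' : ℝ⟦X⟧}
    (h : Majorizes p f g) (h' : Majorizes p f' g') : Majorizes p (f * f') (g * g') := by
  intro k
  rw [coeff_mul, coeff_mul]
  refine (seminorm_sum_le _ _).trans (sum_le_sum fun ij _ => (hmul _ _).trans ?_)
  exact mul_le_mul (h _) (h' _) (apply_nonneg _ _) ((apply_nonneg _ _).trans (h _))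

theorem majorizes_one (h1 : p 1 ≤ 1) : Majorizes p 1 1 := by
  intro k
  rw [coeff_one, coeff_one]
  split_ifs with h
  · exact h1
  · simp

theorem Majorizes.prod (h1 : p 1 ≤ 1) (hmul : ∀ a b, p (a * b) ≤ p a * p b) {ι : Type*}
    (s : Finset ι) {f : ι → R⟦X⟧} {g : ι → ℝ⟦X⟧} (h : ∀ i, Majorizes p (f i) (g i)) :
    Majorizes p (∏ i ∈ s, f i) (∏ i ∈ s, g i) := by
  classical
  induction s using Finset.induction_on with
  | empty => simpa using majorizes_one h1
  | insert a s ha ih =>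
    rw [prod_insert ha, prod_insert ha]
    exact (h a).mul hmul ih

theorem seminorm_pow_le (h1 : p 1 ≤ 1) (hmul : ∀ a b, p (a * b) ≤ p a * p b) (a : R) (k : ℕ) :
    p (a ^ k) ≤ p a ^ k := by
  induction k with
  | zero => simpa using h1
  | succ k ih =>
    rw [pow_succ, pow_succ]
    exact (hmul _ _).trans (by gcongr)

theorem majorizes_expSeries (h1 : p 1 ≤ 1) (hmul : ∀ a b, p (a * b) ≤ p a * p b) (A : R) :
    Majorizes p (expSeries A) (expSeries (p A)) := by
  intro k
  rw [coeff_expSeries, coeff_expSeries, map_smul_eq_mul, Real.norm_of_nonneg (by positivity),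
    smul_eq_mul]
  gcongr
  exact seminorm_pow_le h1 hmul A k

theorem majorizes_gSeries (h1 : p 1 ≤ 1) (hmul : ∀ a b, p (a * b) ≤ p a * p b) (M : R) :
    Majorizes p ((1 + C M * X) * expSeries (-M)) (gSeries (p M)) := by
  intro k
  rcases k with _ | k
  · rw [coeff_gSeries_zero]
    have e : coeff 0 ((1 + C M * X) * expSeries (-M)) = 1 := by
      rw [add_mul, one_mul, map_add, mul_assoc, coeff_C_mul, coeff_zero_X_mul, coeff_expSeries]
      simp
    rw [e]
    exact h1
  · rw [coeff_one_add_mul_expSeries_neg, coeff_gSeries_succ, map_smul_eq_mul, norm_mul, norm_pow,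
      norm_neg, norm_one, one_pow, one_mul, Real.norm_of_nonneg (by positivity)]
    gcongr
    exact seminorm_pow_le h1 hmul M _

/-- Factoring out `exp(z ∑ M_j)` first keeps the norm of the sum, where cancellation is visible,
instead of the sum of the norms; what remains of each factor starts at second order. -/
theorem majorizes_prod_one_add (h1 : p 1 ≤ 1) (hmul : ∀ a b, p (a * b) ≤ p a * p b) {ι : Type*}
    (s : Finset ι) (M : ι → R) :
    Majorizes p (∏ j ∈ s, (1 + C (M j) * X))
      (expSeries (p (∑ j ∈ s, M j)) * ∏ j ∈ s, gSeries (p (M j))) := by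
  have e : ∏ j ∈ s, (1 + C (M j) * X) =
      expSeries (∑ j ∈ s, M j) * ∏ j ∈ s, ((1 + C (M j) * X) * expSeries (-M j)) := by
    rw [prod_mul_distrib, ← expSeries_sum, sum_neg_distrib, mul_left_comm, ← expSeries_add,
      add_neg_cancel, expSeries_zero, mul_one]
  rw [e]
  exact (majorizes_expSeries h1 hmul _).mul hmul
    (Majorizes.prod h1 hmul s fun j => majorizes_gSeries h1 hmul (M j))

end PowerSeriesMajorants

/-! ### Cauchy estimates for series with nonnegative coefficients. -/

section PartialSums

open PowerSeries Finset

/-- All coefficients are nonnegative, and the value at `r` is at most `B`. -/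
def BoundedAt (r B : ℝ) (h : ℝ⟦X⟧) : Prop :=
  (∀ k, 0 ≤ coeff k h) ∧ ∀ N, ∑ k ∈ range N, coeff k h * r ^ k ≤ B

theorem BoundedAt.nonneg {r B : ℝ} {h : ℝ⟦X⟧} (hh : BoundedAt r B h) : 0 ≤ B := by
  simpa using hh.2 0

theorem BoundedAt.mul {r B B' : ℝ} (hr : 0 ≤ r) {h h' : ℝ⟦X⟧} (hh : BoundedAt r B h)
    (hh' : BoundedAt r B' h') : BoundedAt r (B * B') (h * h') := by
  refine ⟨fun k => ?_, fun N => ?_⟩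
  · rw [coeff_mul]
    exact sum_nonneg fun ij _ => mul_nonneg (hh.1 _) (hh'.1 _)
  · calc ∑ k ∈ range N, coeff k (h * h') * r ^ k
        = ∑ k ∈ range N, ∑ ij ∈ antidiagonal k,
            (coeff ij.1 h * r ^ ij.1) * (coeff ij.2 h' * r ^ ij.2) := by
          refine sum_congr rfl fun k _ => ?_
          rw [coeff_mul, sum_mul]
          refine sum_congr rfl fun ij hij => ?_
          rw [← HasAntidiagonal.mem_antidiagonal.1 hij, pow_add]; ring
      -- The antidiagonals below `N` are disjoint and lie in the square, and all terms are
      -- nonnegative.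
      _ ≤ ∑ ij ∈ range N ×ˢ range N, (coeff ij.1 h * r ^ ij.1) * (coeff ij.2 h' * r ^ ij.2) := by
          rw [← sum_biUnion]
          · refine sum_le_sum_of_subset_of_nonneg ?_ fun ij _ _ =>
              mul_nonneg (mul_nonneg (hh.1 _) (by positivity))
                (mul_nonneg (hh'.1 _) (by positivity))
            intro ij hij
            simp only [mem_biUnion, mem_range, HasAntidiagonal.mem_antidiagonal, mem_product] at hij ⊢
            obtain ⟨k, hk, hij⟩ := hij
            omega
          · intro a _ b _ hab
            rw [Function.onFun, Finset.disjoint_left]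
            intro ij h1 h2
            exact hab ((HasAntidiagonal.mem_antidiagonal.1 h1).symm.trans (HasAntidiagonal.mem_antidiagonal.1 h2))
      _ = (∑ k ∈ range N, coeff k h * r ^ k) * ∑ k ∈ range N, coeff k h' * r ^ k := by
          rw [sum_mul_sum, sum_product]
      _ ≤ B * B' := mul_le_mul (hh.2 N) (hh'.2 N)
          (sum_nonneg fun k _ => mul_nonneg (hh'.1 _) (by positivity)) hh.nonneg

theorem BoundedAt.prod {r : ℝ} (hr : 0 ≤ r) {ι : Type*} (s : Finset ι) {B : ι → ℝ}
    {h : ι → ℝ⟦X⟧} (hh : ∀ i, BoundedAt r (B i) (h i)) :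
    BoundedAt r (∏ i ∈ s, B i) (∏ i ∈ s, h i) := by
  classical
  induction s using Finset.induction_on with
  | empty =>
    refine ⟨fun k => ?_, fun N => ?_⟩
    · rw [prod_empty, coeff_one]; split_ifs <;> norm_num
    · simp only [prod_empty, coeff_one, ite_mul, zero_mul, one_mul, sum_ite_eq']
      split_ifs <;> norm_num
  | insert a s ha ih =>
    rw [prod_insert ha, prod_insert ha]
    exact (hh a).mul hr ih

theorem hasSum_gSeries (y : ℝ) :
    HasSum (fun k => coeff k (gSeries y)) (2 - (1 - y) * Real.exp y) := by
  have h : HasSum (fun k : ℕ => (k.factorial : ℝ)⁻¹ * y ^ k) (Real.exp y) := by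
    have := NormedSpace.expSeries_div_hasSum_exp y
    rw [← Real.exp_eq_exp_ℝ] at this
    simpa [div_eq_inv_mul] using this
  have h1 : HasSum (fun k : ℕ => ((k + 1).factorial : ℝ)⁻¹ * y ^ (k + 1)) (Real.exp y - 1) := by
    have := (hasSum_nat_add_iff' 1).2 h
    simpa using this
  -- Beyond the constant term `1` the series is `y e^y - (e^y - 1)`, because `k/(k+1)! = 1/k! -
  -- 1/(k+1)!`.
  have h2 := (h.mul_left y).sub h1
  rw [← hasSum_nat_add_iff' 1]
  convert! h2 using 1
  · ext k
    rw [coeff_gSeries_succ]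
    have h3 : (k.factorial : ℝ) ≠ 0 := by exact_mod_cast k.factorial_ne_zero
    rw [Nat.factorial_succ]
    push_cast
    field_simp
    ring
  · simp [coeff_gSeries_zero]; ring

theorem boundedAt_gSeries {r m : ℝ} (hr : 0 ≤ r) (hm : 0 ≤ m) :
    BoundedAt r (2 - (1 - r * m) * Real.exp (r * m)) (gSeries m) := by
  refine ⟨coeff_gSeries_nonneg hm, fun N => ?_⟩
  have e : ∀ k, coeff k (gSeries m) * r ^ k = coeff k (gSeries (r * m)) := by
    intro k
    simp only [gSeries, coeff_mk, mul_pow]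
    ring
  simp only [e]
  exact sum_le_hasSum _ (fun k _ => coeff_gSeries_nonneg (mul_nonneg hr hm) k) (hasSum_gSeries _)

/-- Squared, with `t = x²/2`, this reads `(2t)^i ≤ i!² e^t`. For `i ≥ 4` it follows from `t^i ≤ i!
e^t` and `2^i ≤ i!`; the four smaller cases come from elementary lower bounds for `e^t`. -/
theorem pow_div_factorial_le_exp (x : ℝ) (i : ℕ) :
    (i.factorial : ℝ)⁻¹ * x ^ i ≤ Real.exp (x ^ 2 / 4) := by
  have hi : (0 : ℝ) < i.factorial := by exact_mod_cast i.factorial_pos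
  have key : ∀ t : ℝ, 0 ≤ t → (2 * t) ^ i ≤ (i.factorial : ℝ) ^ 2 * Real.exp t := by
    intro t ht
    have hexp := Real.pow_div_factorial_le_exp t ht i
    rw [div_le_iff₀ hi] at hexp
    have q := Real.quadratic_le_exp_of_nonneg ht
    rcases lt_or_ge i 4 with h | h
    · interval_cases i
      · simpa using Real.one_le_exp ht
      · norm_num; nlinarith [Real.add_one_le_exp t, sq_nonneg (t - 1)]
      · have h4 := Real.sum_le_exp_of_nonneg ht 4
        simp [Finset.sum_range_succ, Nat.factorial] at h4
        norm_num [Nat.factorial]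
        nlinarith [mul_nonneg ht (sq_nonneg (t - 3 / 2))]
      · have h4 := Real.sum_le_exp_of_nonneg ht 6
        simp [Finset.sum_range_succ, Nat.factorial] at h4
        norm_num [Nat.factorial]
        nlinarith [sq_nonneg (t - 2), sq_nonneg (t * (t - 2)), mul_nonneg ht (sq_nonneg (t - 2)), mul_nonneg ht (sq_nonneg (t*(t - 2))), mul_nonneg ht (sq_nonneg (t*(t - 4))), mul_nonneg ht (sq_nonneg t)]
    · have h2 : (2 : ℝ) ^ i ≤ i.factorial := by
        have h2 : 2 ^ i ≤ i.factorial := by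
          induction i, h using Nat.le_induction with
          | base => decide
          | succ n hn ih =>
            have := ih (by positivity) (by
              have := Real.pow_div_factorial_le_exp t ht n
              rwa [div_le_iff₀ (by positivity)] at this)
            rw [pow_succ, Nat.factorial_succ]; nlinarith
        exact_mod_cast h2
      rw [mul_pow]
      calc (2 : ℝ) ^ i * t ^ i ≤ i.factorial * (Real.exp t * i.factorial) := by gcongr
        _ = _ := by ring
  have h := key (x ^ 2 / 2) (by positivity)
  have e : (2 * (x ^ 2 / 2)) ^ i = (x ^ i) ^ 2 := by rw [← pow_mul, mul_comm i 2, pow_mul]; congr 1; ring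
  have e' : Real.exp (x ^ 2 / 2) = Real.exp (x ^ 2 / 4) ^ 2 := by
    rw [← Real.exp_nat_mul]; congr 1; push_cast; ring
  rw [e, e', ← mul_pow] at h
  have := le_of_sq_le_sq h (by positivity)
  rw [inv_mul_le_iff₀ hi]
  exact this

/-- In the Cauchy product only `h` is summed, while each exponential coefficient is replaced by a
uniform bound. This gives `exp((ra)²/4)` in place of `exp(ra)`, so that `a` enters quadratically, on
the same footing as the squares coming from `g(x) ≤ exp(c₁ x²)`. -/
theorem coeff_expSeries_mul_le {r a B : ℝ} (hr : 0 ≤ r) {h : ℝ⟦X⟧}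
    (hh : BoundedAt r B h) (k : ℕ) :
    coeff k (expSeries a * h) * r ^ k ≤ Real.exp ((r * a) ^ 2 / 4) * B := by
  rw [coeff_mul, sum_mul]
  calc ∑ ij ∈ antidiagonal k, coeff ij.1 (expSeries a) * coeff ij.2 h * r ^ k
      ≤ ∑ ij ∈ antidiagonal k, Real.exp ((r * a) ^ 2 / 4) * (coeff ij.2 h * r ^ ij.2) := by
        refine sum_le_sum fun ij hij => ?_
        have h1 := pow_div_factorial_le_exp (r * a) ij.1
        rw [← HasAntidiagonal.mem_antidiagonal.1 hij, pow_add, coeff_expSeries, smul_eq_mul]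
        calc _ = ((ij.1.factorial : ℝ)⁻¹ * (r * a) ^ ij.1) * (coeff ij.2 h * r ^ ij.2) := by
              rw [mul_pow]; ring
          _ ≤ _ := mul_le_mul_of_nonneg_right h1 (mul_nonneg (hh.1 _) (by positivity))
    _ = Real.exp ((r * a) ^ 2 / 4) * ∑ k ∈ range (k + 1), coeff k h * r ^ k := by
        rw [← mul_sum]
        congr 1
        rw [← Nat.sum_antidiagonal_swap]
        exact Nat.sum_antidiagonal_eq_sum_range_succ (fun i _ => coeff i h * r ^ i) k
    _ ≤ _ := mul_le_mul_of_nonneg_left (hh.2 _) (Real.exp_pos _).le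

end PartialSums

/-! ### The constant `c₁` and the bound `c₁ ≤ 0.6942`. -/

section ExponentialConstant

open Set

theorem hasDerivAt_exp_sub_two_add (c x : ℝ) :
    HasDerivAt (fun x : ℝ => Real.exp (c * x ^ 2) - 2 + (1 - x) * Real.exp x)
      (x * (2 * c * Real.exp (c * x ^ 2) - Real.exp x)) x := by
  have h1 : HasDerivAt (fun x : ℝ => Real.exp (c * x ^ 2)) (Real.exp (c * x ^ 2) * (c * (2 * x))) x := by
    have := ((hasDerivAt_id x).pow 2).const_mul c
    simpa using this.exp
  have h2 : HasDerivAt (fun x : ℝ => (1 - x) * Real.exp x)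
      ((-1) * Real.exp x + (1 - x) * Real.exp x) x :=
    ((hasDerivAt_id x).const_sub 1).mul (Real.hasDerivAt_exp x)
  convert! (h1.sub_const 2).add h2 using 1
  ring

/-- The exponent `x - c x²` is concave, so between two points it stays above the smaller of its end
values. -/
theorem two_mul_exp_le_exp_of_between {c u w x : ℝ} (hc : 0 ≤ c) (hux : u ≤ x) (hxw : x ≤ w)
    (hu : 2 * c ≤ Real.exp (u - c * u ^ 2)) (hw : 2 * c ≤ Real.exp (w - c * w ^ 2)) :
    2 * c * Real.exp (c * x ^ 2) ≤ Real.exp x := by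
  have h : 2 * c ≤ Real.exp (x - c * x ^ 2) := by
    rcases le_total (1 - c * (x + u)) 0 with h | h
    · refine hw.trans (Real.exp_le_exp.2 ?_)
      nlinarith [mul_nonneg hc (sub_nonneg.2 (hux.trans hxw)),
        mul_nonneg (sub_nonneg.2 hxw) (mul_nonneg hc (sub_nonneg.2 (hux.trans hxw)))]
    · refine hu.trans (Real.exp_le_exp.2 ?_)
      nlinarith [mul_nonneg (sub_nonneg.2 hux) h]
  calc 2 * c * Real.exp (c * x ^ 2) ≤ Real.exp (x - c * x ^ 2) * Real.exp (c * x ^ 2) := by gcongr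
    _ = Real.exp x := by rw [← Real.exp_add]; ring_nf

/-- Beyond its vertex `1/(2c)` the parabola `x - c x²` decreases. -/
theorem exp_le_two_mul_exp_of_ge {c w x : ℝ} (hc : 0 ≤ c) (hw : 1 ≤ 2 * c * w) (hwx : w ≤ x)
    (h : Real.exp (w - c * w ^ 2) ≤ 2 * c) :
    Real.exp x ≤ 2 * c * Real.exp (c * x ^ 2) := by
  have h' : Real.exp (x - c * x ^ 2) ≤ 2 * c := by
    refine le_trans (Real.exp_le_exp.2 ?_) h
    nlinarith [mul_nonneg hc (sub_nonneg.2 hwx), mul_nonneg (sub_nonneg.2 hwx) (sub_nonneg.2 hw),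
      mul_nonneg (sub_nonneg.2 hwx) (mul_nonneg hc (sub_nonneg.2 hwx))]
  calc Real.exp x = Real.exp (x - c * x ^ 2) * Real.exp (c * x ^ 2) := by
        rw [← Real.exp_add]; ring_nf
    _ ≤ _ := by gcongr

/-- The difference `φ` of the two sides has derivative `x (2c e^(c x²) - e^x)` with `c = 0.6942`.
Its critical local minimum lies between `0.93485` and `0.9349`, where `φ` is only barely positive.
Taylor polynomials settle `[0, 0.65]`, monotonicity reduces the rest to this short interval, and
there the two monotone parts are bounded at opposite ends. -/
theorem two_sub_le_exp_mul_sq {x : ℝ} (hx : 0 ≤ x) :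
    2 - (1 - x) * Real.exp x ≤ Real.exp (0.6942 * x ^ 2) := by
  set φ := fun x : ℝ => Real.exp (0.6942 * x ^ 2) - 2 + (1 - x) * Real.exp x with hφ
  have hd : ∀ x, HasDerivAt φ _ x := hasDerivAt_exp_sub_two_add 0.6942
  have hcont : Continuous φ := by fun_prop
  suffices h : 0 ≤ φ x by simp only [hφ] at h; linarith
  have lower : ∀ y : ℝ, 0 ≤ y → ∀ n, ∑ i ∈ Finset.range n, y ^ i / i.factorial ≤ Real.exp y :=
    fun y hy n => Real.sum_le_exp_of_nonneg hy n
  have ea : 2 * 0.6942 ≤ Real.exp (0.93485 - 0.6942 * 0.93485 ^ 2) := by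
    refine le_trans ?_ (lower _ (by norm_num) 9)
    norm_num [Finset.sum_range_succ, Nat.factorial]
  have eb : Real.exp (0.9349 - 0.6942 * 0.9349 ^ 2) ≤ 2 * 0.6942 := by
    refine (Real.exp_bound' (by norm_num) (by norm_num) (n := 9) (by norm_num)).trans ?_
    norm_num [Finset.sum_range_succ, Nat.factorial]
  have ea' : (1.834275 : ℝ) ≤ Real.exp (0.6942 * 0.93485 ^ 2) := by
    refine le_trans ?_ (lower _ (by norm_num) 10)
    norm_num [Finset.sum_range_succ, Nat.factorial]
  have eb' : 2 - (1 - 0.9349) * Real.exp 0.9349 ≤ 1.834275 := by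
    have := lower 0.9349 (by norm_num) 10
    norm_num [Finset.sum_range_succ, Nat.factorial] at this
    linarith
  have gap : ∀ x ∈ Icc (0.93485 : ℝ) 0.9349, 0 ≤ φ x := by
    intro x hx
    have h1 : Real.exp (0.6942 * 0.93485 ^ 2) ≤ Real.exp (0.6942 * x ^ 2) := by
      have := hx.1
      gcongr
    have h2 : (1 - 0.9349) * Real.exp 0.9349 ≤ (1 - x) * Real.exp x := by
      have e : Real.exp 0.9349 = Real.exp x * Real.exp (0.9349 - x) := by
        rw [← Real.exp_add]; ring_nf
      have h3 : (1 - 0.9349) * Real.exp (0.9349 - x) ≤ 1 - x := by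
        have h4 : Real.exp (0.9349 - x) ≤ (1 - (0.9349 - x))⁻¹ := by
          have := Real.one_sub_le_exp_neg (0.9349 - x)
          rw [Real.exp_neg] at this
          rw [le_inv_comm₀ (Real.exp_pos _) (by linarith [hx.1])]
          exact this
        have h5 : 0 < 1 - (0.9349 - x) := by linarith [hx.1]
        refine (mul_le_mul_of_nonneg_left h4 (by norm_num)).trans ?_
        rw [mul_inv_le_iff₀ h5]
        nlinarith [mul_nonneg (sub_nonneg.2 hx.1) (sub_nonneg.2 hx.2), hx.1, hx.2]
      rw [e]
      nlinarith [Real.exp_pos x]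
    simp only [hφ]
    linarith
  rcases le_total x 0.65 with h | h
  · have h1 := lower x hx 5
    have h2 := lower (0.6942 * x ^ 2) (by positivity) 3
    simp [Finset.sum_range_succ, Nat.factorial] at h1 h2
    have h3 := mul_le_mul_of_nonneg_left h1 (show 0 ≤ 1 - x by linarith)
    -- This is the Taylor lower bound for `φ`, with `0.1942 = 0.6942 - 1/2` and `0.1159` just below
    -- `0.6942²/2 - 1/8`.
    have h4 : 0 ≤ x ^ 2 * (0.1942 - x / 3 + 0.1159 * x ^ 2 - x ^ 3 / 24) := by
      refine mul_nonneg (sq_nonneg x) ?_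
      nlinarith [mul_nonneg hx (sub_nonneg.2 h), mul_nonneg (sq_nonneg x) (sub_nonneg.2 h), sq_nonneg (x - 0.65)]
    have h5 : (0:ℝ) ≤ x ^ 4 := by positivity
    simp only [hφ]
    nlinarith
  rcases le_total x 0.93485 with h' | h'
  · have anti : AntitoneOn φ (Icc 0.65 0.93485) := by
      refine antitoneOn_of_deriv_nonpos (convex_Icc _ _) hcont.continuousOn
        (fun y _ => (hd y).differentiableAt.differentiableWithinAt) fun y hy => ?_
      rw [interior_Icc] at hy
      rw [(hd y).deriv]
      have : 2 * 0.6942 * Real.exp (0.6942 * y ^ 2) ≤ Real.exp y := by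
        refine two_mul_exp_le_exp_of_between (by norm_num) hy.1.le hy.2.le ?_ ea
        refine le_trans ?_ (lower _ (by norm_num) 4)
        norm_num [Finset.sum_range_succ, Nat.factorial]
      exact mul_nonpos_of_nonneg_of_nonpos (by linarith [hy.1]) (by linarith)
    exact (gap _ ⟨le_rfl, by norm_num⟩).trans (anti ⟨h, h'⟩ ⟨by norm_num, le_rfl⟩ h')
  rcases le_total x 0.9349 with h'' | h''
  · exact gap x ⟨h', h''⟩
  · have mono : MonotoneOn φ (Ici 0.9349) := by
      refine monotoneOn_of_deriv_nonneg (convex_Ici _) hcont.continuousOn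
        (fun y _ => (hd y).differentiableAt.differentiableWithinAt) fun y hy => ?_
      rw [interior_Ici] at hy
      rw [(hd y).deriv]
      have hy' : 0.9349 < y := hy
      have := exp_le_two_mul_exp_of_ge (by norm_num) (by norm_num) hy'.le eb
      exact mul_nonneg (by linarith) (by linarith)
    exact (gap _ ⟨by norm_num, le_rfl⟩).trans (mono (mem_Ici.2 le_rfl) h'' h'')

theorem one_le_two_sub (x : ℝ) : 1 ≤ 2 - (1 - x) * Real.exp x := by
  have h := Real.one_sub_le_exp_neg x
  have h2 : (1 - x) * Real.exp x ≤ Real.exp (-x) * Real.exp x := by gcongr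
  rw [← Real.exp_add, neg_add_cancel, Real.exp_zero] at h2
  linarith

theorem log_two_sub_div_le {x : ℝ} (hx : 0 < x) :
    Real.log (2 - (1 - x) * Real.exp x) / x ^ 2 ≤ 0.6942 := by
  rw [div_le_iff₀ (by positivity), Real.log_le_iff_le_exp (by linarith [one_le_two_sub x])]
  exact two_sub_le_exp_mul_sq hx.le

theorem bddAbove_c₁ :
    BddAbove ((fun x : ℝ => Real.log (2 - (1 - x) * Real.exp x) / x ^ 2) '' Ioi 0) := by
  refine ⟨0.6942, ?_⟩
  rintro _ ⟨x, hx, rfl⟩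
  exact log_two_sub_div_le hx

theorem c₁_le : c₁ ≤ 0.6942 := by
  refine csSup_le ⟨_, 1, Set.mem_Ioi.2 one_pos, rfl⟩ ?_
  rintro _ ⟨x, hx, rfl⟩
  exact log_two_sub_div_le hx

theorem c₁_pos : 0 < c₁ := by
  -- At `x = 1` the quotient equals `log 2`.
  have h := le_csSup bddAbove_c₁ ⟨1, Set.mem_Ioi.2 one_pos, rfl⟩
  refine lt_of_lt_of_le ?_ h
  simpa using Real.log_pos one_lt_two

theorem two_sub_le_exp_c₁ {x : ℝ} (hx : 0 ≤ x) :
    2 - (1 - x) * Real.exp x ≤ Real.exp (c₁ * x ^ 2) := by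
  rcases hx.eq_or_lt with rfl | hx
  · norm_num
  have h := le_csSup bddAbove_c₁ ⟨x, Set.mem_Ioi.2 hx, rfl⟩
  rw [div_le_iff₀ (by positivity), Real.log_le_iff_le_exp (by linarith [one_le_two_sub x])] at h
  exact h

theorem two_mul_exp_mul_c₁_pos : 0 < 2 * Real.exp 1 * c₁ := by
  have := c₁_pos
  positivity

theorem two_mul_exp_mul_c₁_le : 2 * Real.exp 1 * c₁ ≤ 3.7741 := by
  have h1 := c₁_le
  have h2 := Real.exp_one_lt_d9
  have h3 := c₁_pos
  nlinarith

end ExponentialConstant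

/-! ### Norm bounds for elementary symmetric functions. -/

section ElementarySymmetric

open PowerSeries Finset Filter Topology

variable {R : Type*} [CommRing R] [Algebra ℝ R] {p : Seminorm ℝ R}

theorem seminorm_esymm_le (h1 : p 1 ≤ 1) (hmul : ∀ a b, p (a * b) ≤ p a * p b) {ι : Type*}
    (s : Finset ι) (M : ι → R) {k : ℕ} (hk : 1 ≤ k) {t : ℝ} (ht : 0 ≤ t)
    (h : (1 / (k : ℝ)) * (p (∑ j ∈ s, M j) ^ 2 / (4 * c₁) + ∑ j ∈ s, p (M j) ^ 2) ≤ t ^ 2) :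
    p (∑ J ∈ s.powersetCard k, ∏ j ∈ J, M j) ≤ (√(2 * Real.exp 1 * c₁) * t) ^ k := by
  have hc := c₁_pos
  have hk' : (0 : ℝ) < k := by exact_mod_cast hk
  -- The radius below would be infinite for `t = 0`, hence the bound is proved for positive `u ≥ t`,
  -- and then `u` decreases to `t`.
  have key : ∀ u, 0 < u → t ≤ u → p (∑ J ∈ s.powersetCard k, ∏ j ∈ J, M j) ≤
      (√(2 * Real.exp 1 * c₁) * u) ^ k := by
    intro u hu htu
    -- This radius minimizes `r^(-k) exp(c₁ r² k u²)`; the exponent becomes `k/2`.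
    set r := (√(2 * c₁) * u)⁻¹ with hr
    have hs : 0 < √(2 * c₁) := by positivity
    have hrpos : 0 < r := by positivity
    have hr2 : c₁ * r ^ 2 * (k * u ^ 2) = k / 2 := by
      rw [hr, inv_pow, mul_pow, Real.sq_sqrt (by positivity)]
      field_simp
    have hb := majorizes_prod_one_add h1 hmul s M k
    rw [coeff_prod_one_add] at hb
    refine hb.trans ?_
    have hB : BoundedAt r (∏ j ∈ s, (2 - (1 - r * p (M j)) * Real.exp (r * p (M j))))
        (∏ j ∈ s, gSeries (p (M j))) :=
      BoundedAt.prod hrpos.le s fun j => boundedAt_gSeries hrpos.le (apply_nonneg p _)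
    have h2 := coeff_expSeries_mul_le (a := p (∑ j ∈ s, M j)) hrpos.le hB k
    have h3 : ∏ j ∈ s, (2 - (1 - r * p (M j)) * Real.exp (r * p (M j))) ≤
        Real.exp (∑ j ∈ s, c₁ * (r * p (M j)) ^ 2) := by
      rw [Real.exp_sum]
      exact prod_le_prod (fun j _ => zero_le_one.trans (one_le_two_sub _)) fun j _ =>
        two_sub_le_exp_c₁ (mul_nonneg hrpos.le (apply_nonneg p _))
    have h4 : (r * p (∑ j ∈ s, M j)) ^ 2 / 4 + ∑ j ∈ s, c₁ * (r * p (M j)) ^ 2 ≤ k / 2 := by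
      have e : (r * p (∑ j ∈ s, M j)) ^ 2 / 4 + ∑ j ∈ s, c₁ * (r * p (M j)) ^ 2 =
          c₁ * r ^ 2 * (p (∑ j ∈ s, M j) ^ 2 / (4 * c₁) + ∑ j ∈ s, p (M j) ^ 2) := by
        rw [mul_add, mul_sum]
        congr 1
        · field_simp
        · exact sum_congr rfl fun j _ => by ring
      rw [e, ← hr2]
      have h5 : p (∑ j ∈ s, M j) ^ 2 / (4 * c₁) + ∑ j ∈ s, p (M j) ^ 2 ≤ k * t ^ 2 := by
        rwa [one_div, inv_mul_le_iff₀ hk'] at h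
      refine mul_le_mul_of_nonneg_left (h5.trans ?_) (by positivity)
      gcongr
    have h5 : coeff k (expSeries (p (∑ j ∈ s, M j)) * ∏ j ∈ s, gSeries (p (M j))) * r ^ k ≤
        Real.exp (k / 2) := by
      refine h2.trans ((mul_le_mul_of_nonneg_left h3 (Real.exp_pos _).le).trans ?_)
      rw [← Real.exp_add]
      exact Real.exp_le_exp.2 h4
    have h6 : Real.exp (k / 2) = (√(2 * Real.exp 1 * c₁) * u) ^ k * r ^ k := by
      have e1 : √(2 * Real.exp 1 * c₁) = Real.exp (1 / 2) * √(2 * c₁) := by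
        rw [show 2 * Real.exp 1 * c₁ = Real.exp 1 * (2 * c₁) by ring,
          Real.sqrt_mul (Real.exp_pos _).le, Real.exp_half]
      rw [← mul_pow, e1, hr]
      have e2 : Real.exp (1 / 2) * √(2 * c₁) * u * (√(2 * c₁) * u)⁻¹ = Real.exp (1 / 2) := by
        field_simp
      rw [e2, ← Real.exp_nat_mul]
      congr 1
      ring
    rw [h6] at h5
    exact le_of_mul_le_mul_right h5 (by positivity)
  have hlim : Tendsto (fun u : ℝ => (√(2 * Real.exp 1 * c₁) * u) ^ k) (𝓝[>] t)
      (𝓝 ((√(2 * Real.exp 1 * c₁) * t) ^ k)) := by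
    refine tendsto_nhdsWithin_of_tendsto_nhds ?_
    have : Continuous fun u : ℝ => (√(2 * Real.exp 1 * c₁) * u) ^ k := by fun_prop
    exact this.tendsto t
  refine ge_of_tendsto hlim ?_
  filter_upwards [self_mem_nhdsWithin] with u hu
  exact key u (ht.trans_lt hu) (le_of_lt hu)

/-- If the `M_j` sum to zero, only the factors `2 - (1 - m z) exp (m z)` remain. -/
theorem seminorm_esymm_le_coeff (h1 : p 1 ≤ 1) (hmul : ∀ a b, p (a * b) ≤ p a * p b) {ι : Type*}
    (s : Finset ι) (M : ι → R) (h0 : p (∑ j ∈ s, M j) = 0) (k : ℕ) :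
    p (∑ J ∈ s.powersetCard k, ∏ j ∈ J, M j) ≤ coeff k (∏ j ∈ s, gSeries (p (M j))) := by
  have hb := majorizes_prod_one_add h1 hmul s M k
  rwa [coeff_prod_one_add, h0, expSeries_zero, one_mul] at hb

/-- Behind these formulas is `log g(x) = x²/2 + x³/3 - 2x⁵/15 - 5x⁶/72 + 11x⁷/420 + ⋯`: summing over
`j` turns powers into power sums, and exponentiating gives the coefficients. There is no quartic
term, so the fourth coefficient is a pure square. -/
theorem coeff_prod_gSeries {ι : Type*} (s : Finset ι) (m : ι → ℝ) :
    coeff 0 (∏ j ∈ s, gSeries (m j)) = 1 ∧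
    coeff 1 (∏ j ∈ s, gSeries (m j)) = 0 ∧
    coeff 2 (∏ j ∈ s, gSeries (m j)) = (∑ j ∈ s, m j ^ 2) / 2 ∧
    coeff 3 (∏ j ∈ s, gSeries (m j)) = (∑ j ∈ s, m j ^ 3) / 3 ∧
    coeff 4 (∏ j ∈ s, gSeries (m j)) = (∑ j ∈ s, m j ^ 2) ^ 2 / 8 ∧
    coeff 5 (∏ j ∈ s, gSeries (m j)) =
      (∑ j ∈ s, m j ^ 2) * (∑ j ∈ s, m j ^ 3) / 6 - 2 / 15 * ∑ j ∈ s, m j ^ 5 ∧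
    coeff 6 (∏ j ∈ s, gSeries (m j)) =
      (∑ j ∈ s, m j ^ 2) ^ 3 / 48 + (∑ j ∈ s, m j ^ 3) ^ 2 / 18 - 5 / 72 * ∑ j ∈ s, m j ^ 6 ∧
    coeff 7 (∏ j ∈ s, gSeries (m j)) =
      (∑ j ∈ s, m j ^ 2) ^ 2 * (∑ j ∈ s, m j ^ 3) / 24
        - (∑ j ∈ s, m j ^ 2) * (∑ j ∈ s, m j ^ 5) / 15 + 11 / 420 * ∑ j ∈ s, m j ^ 7 := by
  classical
  induction s using Finset.induction_on with
  | empty => simp [coeff_one]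
  | insert a s ha ih =>
    obtain ⟨e0, e1, e2, e3, e4, e5, e6, e7⟩ := ih
    have g0 := coeff_gSeries_zero (m a)
    have g1 : coeff 1 (gSeries (m a)) = 0 := by simp [gSeries]
    have g2 : coeff 2 (gSeries (m a)) = m a ^ 2 / 2 := by norm_num [gSeries, Nat.factorial]; ring
    have g3 : coeff 3 (gSeries (m a)) = m a ^ 3 / 3 := by norm_num [gSeries, Nat.factorial]; ring
    have g4 : coeff 4 (gSeries (m a)) = m a ^ 4 / 8 := by norm_num [gSeries, Nat.factorial]; ring
    have g5 : coeff 5 (gSeries (m a)) = m a ^ 5 / 30 := by norm_num [gSeries, Nat.factorial]; ring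
    have g6 : coeff 6 (gSeries (m a)) = m a ^ 6 / 144 := by norm_num [gSeries, Nat.factorial]; ring
    have g7 : coeff 7 (gSeries (m a)) = m a ^ 7 / 840 := by norm_num [gSeries, Nat.factorial]; ring
    simp only [prod_insert ha, sum_insert ha]
    refine ⟨?_, ?_, ?_, ?_, ?_, ?_, ?_, ?_⟩ <;>
    · rw [coeff_mul, Nat.sum_antidiagonal_eq_sum_range_succ
        (fun i j => coeff i (gSeries (m a)) * coeff j (∏ j ∈ s, gSeries (m j)))]
      simp only [sum_range_succ, sum_range_zero, Nat.reduceSub, e0, e1, e2, e3, e4, e5, e6, e7,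
        g0, g1, g2, g3, g4, g5, g6, g7]
      ring

theorem sum_pow_add_le {ι : Type*} {s : Finset ι} {m : ι → ℝ} {B : ℝ} (hm : ∀ j ∈ s, 0 ≤ m j)
    (hB : ∀ j ∈ s, m j ≤ B) (a b : ℕ) :
    ∑ j ∈ s, m j ^ (a + b) ≤ B ^ b * ∑ j ∈ s, m j ^ a := by
  rw [mul_sum]
  refine sum_le_sum fun j hj => ?_
  rw [pow_add, mul_comm]
  have := hm j hj
  have := hB j hj
  gcongr

theorem le_sqrt_sum_sq {ι : Type*} {s : Finset ι} (m : ι → ℝ) {j : ι} (hj : j ∈ s) :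
    m j ≤ √(∑ i ∈ s, m i ^ 2) :=
  Real.le_sqrt_of_sq_le (single_le_sum (f := fun i => m i ^ 2) (fun _ _ => sq_nonneg _) hj)

theorem sum_pow_add_two_le {ι : Type*} {s : Finset ι} {m : ι → ℝ} (hm : ∀ j ∈ s, 0 ≤ m j)
    (b : ℕ) : ∑ j ∈ s, m j ^ (2 + b) ≤ √(∑ j ∈ s, m j ^ 2) ^ (b + 2) := by
  refine (sum_pow_add_le hm (fun j hj => le_sqrt_sum_sq m hj) 2 b).trans (le_of_eq ?_)
  rw [pow_add, Real.sq_sqrt (sum_nonneg fun _ _ => sq_nonneg _)]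

section ExplicitBounds

variable {ι : Type*} {s : Finset ι} {m : ι → ℝ} {t : ℝ}

theorem coeff_two_prod_gSeries_le (h : ∑ j ∈ s, m j ^ 2 ≤ 2 * t ^ 2) :
    coeff 2 (∏ j ∈ s, gSeries (m j)) ≤ t ^ 2 := by
  rw [(coeff_prod_gSeries s m).2.2.1]
  linarith

theorem sqrt_le_sqrt_mul {a b t : ℝ} (ha : 0 ≤ a) (ht : 0 ≤ t) (h : b ≤ a * t ^ 2) :
    √b ≤ √a * t := by
  refine (Real.sqrt_le_sqrt h).trans (le_of_eq ?_)
  rw [Real.sqrt_mul ha, Real.sqrt_sq ht]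

theorem coeff_three_prod_gSeries_le (hm : ∀ j ∈ s, 0 ≤ m j) (ht : 0 ≤ t)
    (h : ∑ j ∈ s, m j ^ 2 ≤ 3 * t ^ 2) :
    coeff 3 (∏ j ∈ s, gSeries (m j)) ≤ 1.7321 * t ^ 3 := by
  rw [(coeff_prod_gSeries s m).2.2.2.1]
  have h3 := sum_pow_add_two_le hm 1
  have hR := sqrt_le_sqrt_mul (by norm_num) ht h
  have h4 : √(∑ j ∈ s, m j ^ 2) ^ (1 + 2) ≤ (√3 * t) ^ (1 + 2) := by gcongr
  have h5 : √3 ≤ 1.7321 := Real.sqrt_le_iff.2 ⟨by norm_num, by norm_num⟩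
  have h6 : (√3 * t) ^ (1 + 2) = 3 * √3 * t ^ 3 := by
    rw [mul_pow, pow_succ, Real.sq_sqrt (by norm_num)]
  have h7 : √3 * t ^ 3 ≤ 1.7321 * t ^ 3 := by gcongr
  norm_num at h3 h4 h6
  linarith

theorem coeff_four_prod_gSeries_le (h : ∑ j ∈ s, m j ^ 2 ≤ 4 * t ^ 2) :
    coeff 4 (∏ j ∈ s, gSeries (m j)) ≤ 2 * t ^ 4 := by
  rw [(coeff_prod_gSeries s m).2.2.2.2.1]
  have h0 : 0 ≤ ∑ j ∈ s, m j ^ 2 := sum_nonneg fun _ _ => sq_nonneg _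
  have := pow_le_pow_left₀ h0 h 2
  linarith

theorem coeff_five_prod_gSeries_le (hm : ∀ j ∈ s, 0 ≤ m j) (ht : 0 ≤ t)
    (h : ∑ j ∈ s, m j ^ 2 ≤ 5 * t ^ 2) :
    coeff 5 (∏ j ∈ s, gSeries (m j)) ≤ 4.02 * t ^ 5 := by
  rw [(coeff_prod_gSeries s m).2.2.2.2.2.1]
  set B := √(∑ j ∈ s, m j ^ 2) with hB
  have hB0 : 0 ≤ B := Real.sqrt_nonneg _
  have hB2 : B ^ 2 = ∑ j ∈ s, m j ^ 2 := Real.sq_sqrt (sum_nonneg fun _ _ => sq_nonneg _)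
  have hBt : B ≤ √5 * t := sqrt_le_sqrt_mul (by norm_num) ht h
  -- With `v = m_j / B` the quantity to maximize is `v/6 - 2v³/15`. The maximum is at `v = √(5/12) ≈
  -- 0.6455` and is about `0.0717`.
  have h1 : B ^ 2 * (∑ j ∈ s, m j ^ 3) / 6 - 2 / 15 * ∑ j ∈ s, m j ^ 5 ≤ 0.0718 * B ^ 5 := by
    calc _ = ∑ j ∈ s, m j ^ 2 * (B ^ 2 * m j / 6 - 2 / 15 * m j ^ 3) := by
          rw [mul_sum, mul_sum, sum_div, ← sum_sub_distrib]
          exact sum_congr rfl fun j _ => by ring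
      _ ≤ ∑ j ∈ s, m j ^ 2 * (0.0718 * B ^ 3) := by
          refine sum_le_sum fun j hj => mul_le_mul_of_nonneg_left ?_ (sq_nonneg _)
          have h0 := hm j hj
          nlinarith [mul_nonneg h0 (sq_nonneg (m j - 0.6455 * B)),
            mul_nonneg hB0 (sq_nonneg (m j - 0.6455 * B)), pow_nonneg hB0 3]
      _ = 0.0718 * B ^ 5 := by rw [← sum_mul, ← hB2]; ring
  rw [← hB2]
  refine h1.trans ?_
  have h4 : B ^ 5 ≤ (√5 * t) ^ 5 := by gcongr
  have h5 : √5 ≤ 2.23607 := Real.sqrt_le_iff.2 ⟨by norm_num, by norm_num⟩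
  have h6 : (√5 * t) ^ 5 = 25 * (√5 * t ^ 5) := by
    have : √5 ^ 5 = (√5 ^ 2) ^ 2 * √5 := by ring
    rw [mul_pow, this, Real.sq_sqrt (by norm_num)]
    ring
  have h7 : √5 * t ^ 5 ≤ 2.23607 * t ^ 5 := by gcongr
  have h8 : 0 ≤ t ^ 5 := by positivity
  linarith

theorem coeff_six_prod_gSeries_le (hm : ∀ j ∈ s, 0 ≤ m j) (h : ∑ j ∈ s, m j ^ 2 ≤ 6 * t ^ 2) :
    coeff 6 (∏ j ∈ s, gSeries (m j)) ≤ 16.5 * t ^ 6 := by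
  rw [(coeff_prod_gSeries s m).2.2.2.2.2.2.1]
  have h0 : 0 ≤ ∑ j ∈ s, m j ^ 2 := sum_nonneg fun _ _ => sq_nonneg _
  have h3 := sum_pow_add_two_le hm 1
  have h3' : 0 ≤ ∑ j ∈ s, m j ^ (2 + 1) := sum_nonneg fun j hj => pow_nonneg (hm j hj) _
  have h4 := pow_le_pow_left₀ h3' h3 2
  have h5 : (√(∑ j ∈ s, m j ^ 2) ^ (1 + 2)) ^ 2 = (∑ j ∈ s, m j ^ 2) ^ 3 := by
    rw [← pow_mul, mul_comm, pow_mul, Real.sq_sqrt h0]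
  have h6 : 0 ≤ ∑ j ∈ s, m j ^ 6 := sum_nonneg fun j hj => pow_nonneg (hm j hj) _
  have h7 := pow_le_pow_left₀ h0 h 3
  rw [h5] at h4
  norm_num at h4
  linarith

theorem coeff_seven_prod_gSeries_le (hm : ∀ j ∈ s, 0 ≤ m j) (ht : 0 ≤ t)
    (h : ∑ j ∈ s, m j ^ 2 ≤ 7 * t ^ 2) :
    coeff 7 (∏ j ∈ s, gSeries (m j)) ≤ 37.82 * t ^ 7 := by
  rw [(coeff_prod_gSeries s m).2.2.2.2.2.2.2]
  set B := √(∑ j ∈ s, m j ^ 2) with hB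
  have hB0 : 0 ≤ B := Real.sqrt_nonneg _
  have hB2 : B ^ 2 = ∑ j ∈ s, m j ^ 2 := Real.sq_sqrt (sum_nonneg fun _ _ => sq_nonneg _)
  have hBt : B ≤ √7 * t := sqrt_le_sqrt_mul (by norm_num) ht h
  have h3 : ∑ j ∈ s, m j ^ 3 ≤ B ^ 3 := sum_pow_add_two_le hm 1
  -- Since `11/420 < 1/15`, the seventh power sum is absorbed by the negative term with the fifth
  -- one.
  have h7 : ∑ j ∈ s, m j ^ 7 ≤ B ^ 2 * ∑ j ∈ s, m j ^ 5 :=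
    sum_pow_add_le hm (fun j hj => le_sqrt_sum_sq m hj) 5 2
  have h5 : 0 ≤ ∑ j ∈ s, m j ^ 5 := sum_nonneg fun j hj => pow_nonneg (hm j hj) _
  rw [← hB2]
  have h8 : (B ^ 2) ^ 2 * ∑ j ∈ s, m j ^ 3 ≤ (B ^ 2) ^ 2 * B ^ 3 := by gcongr
  have h9 : 0 ≤ B ^ 2 * ∑ j ∈ s, m j ^ 5 := by positivity
  have h4 : B ^ 7 ≤ (√7 * t) ^ 7 := by gcongr
  have h10 : √7 ≤ 2.645752 := Real.sqrt_le_iff.2 ⟨by norm_num, by norm_num⟩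
  have h6 : (√7 * t) ^ 7 = 343 * (√7 * t ^ 7) := by
    have : √7 ^ 7 = (√7 ^ 2) ^ 3 * √7 := by ring
    rw [mul_pow, this, Real.sq_sqrt (by norm_num)]
    ring
  have h11 : √7 * t ^ 7 ≤ 2.645752 * t ^ 7 := by gcongr
  have h12 : 0 ≤ t ^ 7 := by positivity
  have h13 : (B ^ 2) ^ 2 * B ^ 3 = B ^ 7 := by ring
  linarith

end ExplicitBounds

end ElementarySymmetric

/-! ### Expansion of the product and distribution of the powers of `G`. -/

section RingIdentities

open Finset

variable {R ι : Type*} [CommRing R]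

theorem prod_sub_add_eq_sum (s : Finset ι) (f : ι → R) (g : R) :
    ∏ j ∈ s, f j = ∑ k ∈ range (s.card + 1),
      (∑ J ∈ s.powersetCard k, ∏ j ∈ J, (f j - g)) * g ^ (s.card - k) := by
  classical
  have h : ∏ j ∈ s, f j = ∏ j ∈ s, ((f j - g) + g) := prod_congr rfl fun j _ => by ring
  rw [h, prod_add, sum_powerset]
  refine sum_congr rfl fun k _ => ?_
  rw [sum_mul]
  refine sum_congr rfl fun J hJ => ?_
  obtain ⟨hJs, hJk⟩ := mem_powersetCard.1 hJ
  rw [prod_const, card_sdiff_of_subset hJs, hJk]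

/-- Division with remainder, `n - k = k ⌊(n-k)/k⌋ + rest`, gives each of the `k` factors the same
share of `g`. For `k = 0` the conventions for division by zero put the whole power into the rest. -/
theorem esymm_mul_pow (s : Finset ι) (f : ι → R) (g : R) (k : ℕ) :
    (∑ J ∈ s.powersetCard k, ∏ j ∈ J, f j) * g ^ (s.card - k) =
      (∑ J ∈ s.powersetCard k, ∏ j ∈ J, f j * g ^ ((s.card - k) / k)) *
        g ^ ((s.card - k) % k) := by
  rw [sum_mul, sum_mul]
  refine sum_congr rfl fun J hJ => ?_
  rw [prod_mul_distrib, prod_const, (mem_powersetCard.1 hJ).2, mul_assoc, ← pow_mul, ← pow_add]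
  rw [mul_comm _ k, Nat.div_add_mod]

end RingIdentities

/-! ### Bounds for the individual terms of the expansion. -/

section TermBounds

open Finset

variable {X : Type*} [AddCommGroup X] [MeasurableSpace X] [MeasurableSub₂ X] {n : ℕ}

theorem tvSeminorm_one_le : tvSeminorm X 1 ≤ 1 := tvNorm_one_le

theorem tvSeminorm_mul_le (V W : SignedMeasure X) :
    tvSeminorm X (V * W) ≤ tvSeminorm X V * tvSeminorm X W := tvNorm_mul_le V W

theorem tvNorm_sum_le {ι : Type*} (s : Finset ι) (f : ι → SignedMeasure X) :
    tvNorm (∑ i ∈ s, f i) ≤ ∑ i ∈ s, tvNorm (f i) :=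
  seminorm_sum_le (R := SignedMeasure X) (p := tvSeminorm X) s f

theorem tvNorm_sub_le_add (V W : SignedMeasure X) : tvNorm (V - W) ≤ tvNorm V + tvNorm W :=
  map_sub_le_add (tvSeminorm X) V W

theorem tvNorm_sm_pow_le (G : ProbabilityMeasure X) (k : ℕ) : tvNorm (sm G ^ k) ≤ 1 :=
  (seminorm_pow_le (p := tvSeminorm X) tvSeminorm_one_le tvSeminorm_mul_le (sm G) k).trans
    (pow_le_one₀ (tvNorm_nonneg _) (tvNorm_sm G))

theorem tvNorm_prod_sm_le {ι : Type*} (s : Finset ι) (F : ι → ProbabilityMeasure X) :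
    tvNorm (∏ j ∈ s, sm (F j)) ≤ 1 := by
  classical
  induction s using Finset.induction_on with
  | empty => exact tvNorm_one_le
  | insert a s ha ih =>
    rw [prod_insert ha]
    exact (tvNorm_mul_le _ _).trans
      (mul_le_one₀ (tvNorm_sm _) (tvNorm_nonneg _) ih)

variable (F : Fin n → ProbabilityMeasure X) (G : ProbabilityMeasure X)

theorem prod_sm_eq_sum :
    ∏ j, sm (F j) = ∑ k ∈ range (n + 1), Vk F G k * sm G ^ (n - k) := by
  have h := prod_sub_add_eq_sum Finset.univ (fun j => sm (F j)) (sm G)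
  rw [Finset.card_univ, Fintype.card_fin] at h
  exact h

theorem prod_sm_sub_Wl {l : ℕ} (hl : l ≤ n) :
    ∏ j, sm (F j) - Wl F G l = ∑ k ∈ Ico (l + 1) (n + 1), Vk F G k * sm G ^ (n - k) := by
  rw [prod_sm_eq_sum F G, sub_eq_iff_eq_add']
  exact (sum_range_add_sum_Ico (fun k => Vk F G k * sm G ^ (n - k)) (by omega)).symm

theorem Vk_of_lt {k : ℕ} (hk : n < k) : Vk F G k = 0 := by
  unfold Vk
  rw [powersetCard_eq_empty.2 (by simpa using hk), sum_empty]

theorem tvNorm_Vk_mul_of_lt {k : ℕ} (hk : n < k) : tvNorm (Vk F G k * sm G ^ (n - k)) = 0 := by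
  rw [Vk_of_lt F G hk, zero_mul]
  exact tvNorm_zero

theorem tvNorm_Vk_mul_le (k : ℕ) :
    tvNorm (Vk F G k * sm G ^ (n - k)) ≤
      tvNorm (∑ J ∈ (Finset.univ : Finset (Fin n)).powersetCard k, ∏ j ∈ J, Mjk F G j k) := by
  have h := esymm_mul_pow Finset.univ (fun j => sm (F j) - sm G) (sm G) k
  rw [Finset.card_univ, Fintype.card_fin] at h
  have h' : Vk F G k * sm G ^ (n - k) = (∑ J ∈ (Finset.univ : Finset (Fin n)).powersetCard k,
      ∏ j ∈ J, Mjk F G j k) * sm G ^ ((n - k) % k) := h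
  rw [h']
  exact (tvNorm_mul_le _ _).trans
    (mul_le_of_le_one_right (tvNorm_nonneg _) (tvNorm_sm_pow_le _ _))

theorem tvNorm_Vk_zero_mul_le : tvNorm (Vk F G 0 * sm G ^ (n - 0)) ≤ 1 := by
  have h : Vk F G 0 = 1 := by
    unfold Vk
    rw [powersetCard_zero, sum_singleton, prod_empty]
  rw [h, one_mul]
  exact tvNorm_sm_pow_le _ _

theorem eta_term_nonneg (k : ℕ) :
    0 ≤ (1 / (k : ℝ)) * (nuTilde F G k ^ 2 / (4 * c₁) + nu F G k 2) := by
  have hc := c₁_pos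
  have h : 0 ≤ nu F G k 2 := sum_nonneg fun j _ => sq_nonneg _
  positivity

theorem eta_nonneg (l : ℕ) : 0 ≤ eta F G l := by
  refine Real.sSup_nonneg ?_
  rintro _ ⟨k, -, rfl⟩
  exact eta_term_nonneg F G k

theorem le_eta {l k : ℕ} (hlk : l < k) (hkn : k ≤ n) :
    (1 / (k : ℝ)) * (nuTilde F G k ^ 2 / (4 * c₁) + nu F G k 2) ≤ eta F G l :=
  le_csSup ((Finset.finite_toSet _).image _).bddAbove ⟨k, by simp; omega, rfl⟩

theorem eta_rpow (l m : ℕ) : eta F G m ^ (((l : ℝ) + 1) / 2) = √(eta F G m) ^ (l + 1) := by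
  rw [Real.sqrt_eq_rpow, ← Real.rpow_natCast, ← Real.rpow_mul (eta_nonneg F G m)]
  congr 1
  push_cast
  ring

/-- Indices `k > n`, where the term vanishes, are included so that later sums may run past `n`. -/
theorem tvNorm_Vk_mul_le_pow {l k : ℕ} (hlk : l < k) :
    tvNorm (Vk F G k * sm G ^ (n - k)) ≤
      (√(2 * Real.exp 1 * c₁) * √(eta F G l)) ^ k := by
  rcases le_or_gt k n with hk | hk
  · refine (tvNorm_Vk_mul_le F G k).trans ?_
    refine seminorm_esymm_le (p := tvSeminorm X) tvSeminorm_one_le tvSeminorm_mul_le _ _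
      (by omega) (Real.sqrt_nonneg _) ?_
    rw [Real.sq_sqrt (eta_nonneg F G l)]
    exact le_eta F G hlk hk
  · rw [tvNorm_Vk_mul_of_lt F G hk]
    positivity

variable {F G}

theorem sum_Mjk_eq_zero (hn : 1 ≤ n) (hG : sm G = meanF F) (k : ℕ) : ∑ j, Mjk F G j k = 0 := by
  have h0 : (n : ℝ) ≠ 0 := by positivity
  have hs : ∑ j, (sm (F j) - sm G) = 0 := by
    have e : (n : ℝ) • sm G = ∑ j, sm (F j) := by
      rw [hG, meanF, smul_smul, mul_inv_cancel₀ h0, one_smul]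
    have e2 : (n : ℝ) • sm G = n • sm G := Nat.cast_smul_eq_nsmul ℝ n (sm G)
    rw [sum_sub_distrib, sum_const, card_univ, Fintype.card_fin, ← e2, e, sub_self]
  have h : ∑ j, Mjk F G j k = (∑ j, (sm (F j) - sm G)) * sm G ^ ((n - k) / k) :=
    (sum_mul Finset.univ (fun j => sm (F j) - sm G) _).symm
  rw [h, hs, zero_mul]

/-- The deviations from the mean sum to zero; this is the gain of the case `G = F̄`. -/
theorem Vk_one_eq_zero (hn : 1 ≤ n) (hG : sm G = meanF F) : Vk F G 1 * sm G ^ (n - 1) = 0 := by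
  have h := sum_Mjk_eq_zero hn hG 1
  have e := esymm_mul_pow Finset.univ (fun j => sm (F j) - sm G) (sm G) 1
  rw [Finset.card_univ, Fintype.card_fin, Nat.mod_one, pow_zero, mul_one] at e
  refine Eq.trans e ?_
  rw [powersetCard_one, sum_map]
  simpa [Mjk] using h

theorem sum_tvNorm_sq_le {k : ℕ} (hk : 2 ≤ k) (hkn : k ≤ n) :
    ∑ j, tvNorm (Mjk F G j k) ^ 2 ≤ k * √(eta F G 1) ^ 2 := by
  have h := le_eta F G (show 1 < k by omega) hkn
  have hk' : (0 : ℝ) < k := by positivity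
  rw [one_div, inv_mul_le_iff₀ hk'] at h
  rw [Real.sq_sqrt (eta_nonneg F G 1)]
  refine le_trans ?_ h
  have hc := c₁_pos
  have : 0 ≤ nuTilde F G k ^ 2 / (4 * c₁) := by positivity
  exact le_add_of_nonneg_left this

theorem tvNorm_Vk_mul_le_coeff (hn : 1 ≤ n) (hG : sm G = meanF F) (k : ℕ) :
    tvNorm (Vk F G k * sm G ^ (n - k)) ≤
      PowerSeries.coeff k (∏ j, gSeries (tvNorm (Mjk F G j k))) := by
  refine (tvNorm_Vk_mul_le F G k).trans ?_
  refine seminorm_esymm_le_coeff (p := tvSeminorm X) tvSeminorm_one_le tvSeminorm_mul_le _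
    (fun j => Mjk F G j k) ?_ k
  rw [sum_Mjk_eq_zero hn hG, map_zero]

theorem tvNorm_Vk_mul_le_of_coeff (hn : 1 ≤ n) (hG : sm G = meanF F) {k : ℕ} (hk : 2 ≤ k)
    {a : ℝ} (ha : 0 ≤ a)
    (h : ∀ m : Fin n → ℝ, (∀ j ∈ Finset.univ, 0 ≤ m j) → ∑ j, m j ^ 2 ≤ k * √(eta F G 1) ^ 2 →
      PowerSeries.coeff k (∏ j, gSeries (m j)) ≤ a * √(eta F G 1) ^ k) :
    tvNorm (Vk F G k * sm G ^ (n - k)) ≤ a * √(eta F G 1) ^ k := by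
  rcases le_or_gt k n with hkn | hkn
  · exact (tvNorm_Vk_mul_le_coeff hn hG k).trans
      (h _ (fun j _ => tvNorm_nonneg _) (sum_tvNorm_sq_le hk hkn))
  · rw [tvNorm_Vk_mul_of_lt F G hkn]
    positivity

end TermBounds

/-! ### Balancing the two bounds, and the equations for `x`. -/

section RealBounds

open Finset

theorem sum_Ico_pow_le {y : ℝ} (hy : 0 ≤ y) (hy1 : y < 1) (a b : ℕ) :
    ∑ k ∈ Ico a b, y ^ k ≤ y ^ a / (1 - y) := geom_sum_Ico_le_of_lt_one hy hy1

/-- The two bounds coincide at `y = x`. -/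
theorem le_pow_div_of_head_of_tail {x y D a : ℝ} {l b i : ℕ} (hil : i ≤ l + 1) (ha : 0 ≤ a)
    (hx : 0 < x) (hx1 : x < 1) (hxl : a * (1 - x) + x ^ i = 2 * x ^ (l + 1)) (hy : 0 ≤ y)
    (tail : D ≤ ∑ k ∈ Ico (l + 1) b, y ^ k) (head : D ≤ a + ∑ k ∈ Ico i (l + 1), y ^ k) :
    D ≤ y ^ (l + 1) / (1 - x) := by
  rcases le_total y x with h | h
  · refine tail.trans ((sum_Ico_pow_le hy (h.trans_lt hx1) _ _).trans ?_)
    have : 0 < 1 - x := by linarith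
    gcongr
  · have hx1' : 0 < 1 - x := by linarith
    have hxp : 0 < x ^ (l + 1) := by positivity
    have e : a + ∑ k ∈ Ico i (l + 1), x ^ k = x ^ (l + 1) / (1 - x) := by
      rw [eq_div_iff hx1'.ne', add_mul, geom_sum_Ico_mul_neg x hil]
      linarith
    -- Divided by `y^(l+1)`, every term of the head bound decreases in `y`, so `y = x` is the worst
    -- case.
    have key : ∀ k, k ≤ l + 1 → y ^ k * x ^ (l + 1) ≤ y ^ (l + 1) * x ^ k := by
      intro k hk
      obtain ⟨c, hc⟩ := Nat.exists_eq_add_of_le hk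
      rw [hc, pow_add, pow_add]
      have h1 : x ^ c ≤ y ^ c := by gcongr
      calc y ^ k * (x ^ k * x ^ c) = y ^ k * x ^ k * x ^ c := by ring
        _ ≤ y ^ k * x ^ k * y ^ c := by gcongr
        _ = _ := by ring
    have h2 : (a + ∑ k ∈ Ico i (l + 1), y ^ k) * x ^ (l + 1) ≤
        y ^ (l + 1) * (a + ∑ k ∈ Ico i (l + 1), x ^ k) := by
      rw [add_mul, mul_add, sum_mul, mul_sum]
      refine add_le_add ?_ (sum_le_sum fun k hk => key k (mem_Ico.1 hk).2.le)
      have := mul_le_mul_of_nonneg_left (key 0 (Nat.zero_le _)) ha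
      simpa [mul_comm] using this
    rw [e] at h2
    refine head.trans (le_of_mul_le_mul_right (h2.trans (le_of_eq ?_)) hxp)
    ring

theorem exists_unique_root_linear (l : ℕ) : ∃ x : ℝ, 0 < x ∧ x < 1 ∧ x ^ (l + 1) + x / 2 = 1 ∧
    ∀ y : ℝ, 0 < y → y ^ (l + 1) + y / 2 = 1 → y = x := by
  have hc : ContinuousOn (fun x : ℝ => x ^ (l + 1) + x / 2) (Set.Icc 0 1) := by fun_prop
  obtain ⟨x, hx, hxe⟩ := intermediate_value_Icc zero_le_one hc
    (show (1 : ℝ) ∈ Set.Icc _ _ by constructor <;> norm_num)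
  simp only at hxe
  have mono : ∀ a b : ℝ, 0 ≤ a → a < b → a ^ (l + 1) + a / 2 < b ^ (l + 1) + b / 2 := by
    intro a b ha hab
    have : a ^ (l + 1) ≤ b ^ (l + 1) := by gcongr
    linarith
  have h0 : 0 < x := by
    rcases hx.1.eq_or_lt with h | h
    · rw [← h] at hxe; norm_num at hxe
    · exact h
  have h1 : x < 1 := by
    rcases hx.2.eq_or_lt with h | h
    · rw [h] at hxe; norm_num at hxe
    · exact h
  refine ⟨x, h0, h1, hxe, fun y hy hye => ?_⟩
  rcases lt_trichotomy y x with h | h | h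
  · have := mono y x hy.le h; linarith
  · exact h
  · have := mono x y h0.le h; linarith

/-- For `y ≥ 1` the left side is at least `y²/2 + y > 1`, so roots lie below one. There `y - y²/2`
is strictly increasing, which gives uniqueness. -/
theorem exists_unique_root_quadratic {l : ℕ} (hl : 1 ≤ l) :
    ∃ x : ℝ, 0 < x ∧ x < 1 ∧ x ^ (l + 1) - x ^ 2 / 2 + x = 1 ∧
      ∀ y : ℝ, 0 < y → y ^ (l + 1) - y ^ 2 / 2 + y = 1 → y = x := by
  have hc : ContinuousOn (fun x : ℝ => x ^ (l + 1) - x ^ 2 / 2 + x) (Set.Icc 0 1) := by fun_prop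
  obtain ⟨x, hx, hxe⟩ := intermediate_value_Icc zero_le_one hc
    (show (1 : ℝ) ∈ Set.Icc _ _ by constructor <;> norm_num)
  simp only at hxe
  have lt_one : ∀ y : ℝ, 0 ≤ y → y ^ (l + 1) - y ^ 2 / 2 + y = 1 → y < 1 := by
    intro y _ hye
    by_contra! h
    have : y ^ 2 ≤ y ^ (l + 1) := pow_le_pow_right₀ h (by omega)
    nlinarith
  have mono : ∀ a b : ℝ, 0 ≤ a → a < b → b < 1 →
      a ^ (l + 1) - a ^ 2 / 2 + a < b ^ (l + 1) - b ^ 2 / 2 + b := by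
    intro a b ha hab hb
    have : a ^ (l + 1) ≤ b ^ (l + 1) := by gcongr
    nlinarith
  have h0 : 0 < x := by
    rcases hx.1.eq_or_lt with h | h
    · rw [← h] at hxe; norm_num at hxe
    · exact h
  have h1 : x < 1 := lt_one x hx.1 hxe
  refine ⟨x, h0, h1, hxe, fun y hy hye => ?_⟩
  have hy1 := lt_one y hy.le hye
  rcases lt_trichotomy y x with h | h | h
  · have := mono y x hy.le h h1; linarith
  · exact h
  · have := mono x y h0.le h hy1; linarith

end RealBounds

/-! ### Upper bounds for the error, general and numerical. -/

section Upper

open Finset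

variable {X : Type*} [AddCommGroup X] [MeasurableSpace X] [MeasurableSub₂ X] {n : ℕ}
  (F : Fin n → ProbabilityMeasure X) (G : ProbabilityMeasure X)

/-- Appending `d` further indices beyond `n` lets the tail be split at a fixed index whatever `n`
is. -/
theorem tvNorm_sub_Wl_le_tail {l : ℕ} (hl : l ≤ n) (d : ℕ) :
    tvNorm ((∏ j, sm (F j)) - Wl F G l) ≤
      ∑ k ∈ Ico (l + 1) (n + d + 1), tvNorm (Vk F G k * sm G ^ (n - k)) := by
  rw [prod_sm_sub_Wl F G hl]
  refine (tvNorm_sum_le _ _).trans (sum_le_sum_of_subset_of_nonneg ?_ fun _ _ _ => tvNorm_nonneg _)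
  exact Ico_subset_Ico_right (by omega)

theorem tvNorm_sub_Wl_le_head (l : ℕ) :
    tvNorm ((∏ j, sm (F j)) - Wl F G l) ≤
      2 + ∑ k ∈ Ico 1 (l + 1), tvNorm (Vk F G k * sm G ^ (n - k)) := by
  refine (tvNorm_sub_le_add _ _).trans ?_
  have h : tvNorm (Wl F G l) ≤ ∑ k ∈ range (l + 1), tvNorm (Vk F G k * sm G ^ (n - k)) :=
    tvNorm_sum_le _ _
  rw [← sum_range_add_sum_Ico _ (show 1 ≤ l + 1 by omega), sum_range_one] at h
  have h0 := tvNorm_Vk_zero_mul_le F G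
  have h1 := tvNorm_prod_sm_le Finset.univ F
  linarith

theorem tvNorm_sub_Wl_le {l : ℕ} (hl : l ≤ n) {x : ℝ} (hx : 0 < x) (hx1 : x < 1)
    (hxl : x ^ (l + 1) + x / 2 = 1) :
    tvNorm ((∏ j, sm (F j)) - Wl F G l) ≤
      (√(2 * Real.exp 1 * c₁) * √(eta F G 0)) ^ (l + 1) / (1 - x) := by
  refine le_pow_div_of_head_of_tail (a := 2) (i := 1) (b := n + 0 + 1) (by omega) (by norm_num) hx hx1
    (by linarith) (by positivity) ?_ ?_
  · refine (tvNorm_sub_Wl_le_tail F G hl 0).trans (sum_le_sum fun k hk => ?_)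
    have := (mem_Ico.1 hk).1
    exact tvNorm_Vk_mul_le_pow F G (by omega)
  · refine (tvNorm_sub_Wl_le_head F G l).trans (add_le_add le_rfl (sum_le_sum fun k hk => ?_))
    have := (mem_Ico.1 hk).1
    exact tvNorm_Vk_mul_le_pow F G (by omega)

variable {F G}

theorem tvNorm_sub_Wl_le_head_of_mean (hn : 1 ≤ n) (hG : sm G = meanF F) {l : ℕ} (hl : 1 ≤ l) :
    tvNorm ((∏ j, sm (F j)) - Wl F G l) ≤
      2 + ∑ k ∈ Ico 2 (l + 1), tvNorm (Vk F G k * sm G ^ (n - k)) := by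
  refine (tvNorm_sub_Wl_le_head F G l).trans ?_
  rw [sum_eq_sum_Ico_succ_bot (by omega), Vk_one_eq_zero hn hG, tvNorm_zero, zero_add]

theorem tvNorm_sub_Wl_le_of_mean (hn : 1 ≤ n) (hG : sm G = meanF F) {l : ℕ} (hl : 1 ≤ l)
    (hln : l ≤ n) {x : ℝ} (hx : 0 < x) (hx1 : x < 1) (hxl : x ^ (l + 1) - x ^ 2 / 2 + x = 1) :
    tvNorm ((∏ j, sm (F j)) - Wl F G l) ≤
      (√(2 * Real.exp 1 * c₁) * √(eta F G 1)) ^ (l + 1) / (1 - x) := by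
  refine le_pow_div_of_head_of_tail (a := 2) (i := 2) (b := n + 0 + 1) (by omega) (by norm_num) hx hx1
    (by linarith) (by positivity) ?_ ?_
  · refine (tvNorm_sub_Wl_le_tail F G hln 0).trans (sum_le_sum fun k hk => ?_)
    have := (mem_Ico.1 hk).1
    exact tvNorm_Vk_mul_le_pow F G (by omega)
  · refine (tvNorm_sub_Wl_le_head_of_mean hn hG hl).trans
      (add_le_add le_rfl (sum_le_sum fun k hk => ?_))
    have := (mem_Ico.1 hk).1
    exact tvNorm_Vk_mul_le_pow F G (by omega)

theorem sqrt_two_mul_exp_mul_c₁_le : √(2 * Real.exp 1 * c₁) ≤ 1.94271 :=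
  Real.sqrt_le_iff.2 ⟨by norm_num, two_mul_exp_mul_c₁_le.trans (by norm_num)⟩

theorem sum_pow_mul_le {q t B : ℝ} (hq : 0 ≤ q) (ht : 0 ≤ t) (hB : q * t ≤ B) (hB1 : B < 1)
    (a b : ℕ) : ∑ k ∈ Ico a b, (q * t) ^ k ≤ (q * t) ^ a / (1 - B) := by
  refine (sum_Ico_pow_le (mul_nonneg hq ht) (hB.trans_lt hB1) a b).trans ?_
  have : 0 < 1 - B := by linarith
  gcongr

theorem sum_tvNorm_Vk_mul_le {T B : ℝ} (hT : √(eta F G 1) ≤ T) (hB : 1.94271 * T ≤ B) (hB1 : B < 1)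
    {i : ℕ} (hi : 2 ≤ i) (b : ℕ) : ∑ k ∈ Ico i b, tvNorm (Vk F G k * sm G ^ (n - k)) ≤
      (1.94271 * √(eta F G 1)) ^ i / (1 - B) := by
  have hq := sqrt_two_mul_exp_mul_c₁_le
  refine le_trans (sum_le_sum fun k hk => ?_)
    (sum_pow_mul_le (by norm_num) (Real.sqrt_nonneg _) (le_trans (by gcongr) hB) hB1 i b)
  have := (mem_Ico.1 hk).1
  refine (tvNorm_Vk_mul_le_pow F G (show 1 < k by omega)).trans ?_
  gcongr

theorem tvNorm_Vk_two_le (hn : 1 ≤ n) (hG : sm G = meanF F) :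
    tvNorm (Vk F G 2 * sm G ^ (n - 2)) ≤ 1 * √(eta F G 1) ^ 2 :=
  tvNorm_Vk_mul_le_of_coeff hn hG le_rfl zero_le_one fun _ _ h =>
    (coeff_two_prod_gSeries_le h).trans (one_mul _).ge

theorem tvNorm_Vk_three_le (hn : 1 ≤ n) (hG : sm G = meanF F) :
    tvNorm (Vk F G 3 * sm G ^ (n - 3)) ≤ 1.7321 * √(eta F G 1) ^ 3 :=
  tvNorm_Vk_mul_le_of_coeff hn hG (by norm_num) (by norm_num) fun _ hm h =>
    coeff_three_prod_gSeries_le hm (Real.sqrt_nonneg _) h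

/-- Either `10.94 t² ≥ 2` and the trivial bound suffices, or `t ≤ 0.4277`. In the second case the
terms up to `k = 7` use the exact coefficients and the rest is geometric with ratio at most `1.94271
· 0.4277 < 0.83092`. -/
theorem tvNorm_sub_Wl_one_le (hn : 1 ≤ n) (hG : sm G = meanF F) :
    tvNorm ((∏ j, sm (F j)) - Wl F G 1) ≤ 10.94 * √(eta F G 1) ^ 2 := by
  set t := √(eta F G 1) with ht
  have ht0 : 0 ≤ t := Real.sqrt_nonneg _
  have head := tvNorm_sub_Wl_le_head_of_mean hn hG le_rfl
  rw [Ico_self, sum_empty, add_zero] at head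
  rcases le_total 2 (10.94 * t ^ 2) with h | h
  · exact head.trans h
  have ht1 : t ≤ 0.4277 := by nlinarith
  have tail := tvNorm_sub_Wl_le_tail F G hn 8
  obtain ⟨b, hb, hb8⟩ : ∃ b, b = n + 8 + 1 ∧ 8 ≤ b := ⟨_, rfl, by omega⟩
  rw [← hb, ← sum_Ico_consecutive _ (show 2 ≤ 8 by norm_num) hb8] at tail
  simp only [sum_Ico_succ_top, Nat.reduceLeDiff, Ico_self, sum_empty, zero_add] at tail
  have hrest := sum_tvNorm_Vk_mul_le (F := F) (G := G) (B := 0.83092) ht1 (by norm_num) (by norm_num)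
    (show 2 ≤ 8 by norm_num) b
  rw [← ht, mul_pow] at hrest
  have d2 := tvNorm_Vk_two_le hn hG
  have d3 := tvNorm_Vk_three_le hn hG
  have d4 : tvNorm (Vk F G 4 * sm G ^ (n - 4)) ≤ 2 * t ^ 4 :=
    tvNorm_Vk_mul_le_of_coeff hn hG (by norm_num) (by norm_num) fun _ _ h =>
      coeff_four_prod_gSeries_le h
  have d5 : tvNorm (Vk F G 5 * sm G ^ (n - 5)) ≤ 4.02 * t ^ 5 :=
    tvNorm_Vk_mul_le_of_coeff hn hG (by norm_num) (by norm_num) fun _ hm h =>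
      coeff_five_prod_gSeries_le hm ht0 h
  have d6 : tvNorm (Vk F G 6 * sm G ^ (n - 6)) ≤ 16.5 * t ^ 6 :=
    tvNorm_Vk_mul_le_of_coeff hn hG (by norm_num) (by norm_num) fun _ hm h =>
      coeff_six_prod_gSeries_le hm h
  have d7 : tvNorm (Vk F G 7 * sm G ^ (n - 7)) ≤ 37.82 * t ^ 7 :=
    tvNorm_Vk_mul_le_of_coeff hn hG (by norm_num) (by norm_num) fun _ hm h =>
      coeff_seven_prod_gSeries_le hm ht0 h
  have red : ∀ k : ℕ, t ^ (2 + k) ≤ 0.4277 ^ k * t ^ 2 := by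
    intro k
    rw [pow_add, mul_comm]
    gcongr
  have r3 := red 1
  have r4 := red 2
  have r5 := red 3
  have r6 := red 4
  have r7 := red 5
  have r8 := red 6
  have t2 : 0 ≤ t ^ 2 := sq_nonneg t
  rw [← ht] at d2 d3
  norm_num at r3 r4 r5 r6 r7 r8 hrest
  linarith

theorem tvNorm_sub_Wl_two_le (hn : 2 ≤ n) (hG : sm G = meanF F) :
    tvNorm ((∏ j, sm (F j)) - Wl F G 2) ≤ 31.5 * √(eta F G 1) ^ 3 := by
  have hn1 : 1 ≤ n := by omega
  set t := √(eta F G 1) with ht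
  have ht0 : 0 ≤ t := Real.sqrt_nonneg _
  have d2 := tvNorm_Vk_two_le hn1 hG
  have d3 := tvNorm_Vk_three_le hn1 hG
  rw [← ht] at d2 d3
  -- At `t = 0.41` the head bound `2 + t²` is just below `31.5 t³`, while the geometric ratio is
  -- still below `0.8`.
  rcases le_total 0.41 t with h | h
  · have head := tvNorm_sub_Wl_le_head_of_mean hn1 hG (show 1 ≤ 2 by norm_num)
    simp only [sum_Ico_succ_top, Nat.reduceLeDiff, Ico_self, sum_empty, zero_add, Nat.reduceAdd] at head
    have h2 : 0.41 ^ 2 ≤ t ^ 2 := by gcongr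
    have h3 : 0.41 * t ^ 2 ≤ t ^ 3 := by nlinarith [sq_nonneg t]
    linarith
  have tail := tvNorm_sub_Wl_le_tail F G hn 4
  obtain ⟨b, hb, hb4⟩ : ∃ b, b = n + 4 + 1 ∧ 4 ≤ b := ⟨_, rfl, by omega⟩
  rw [← hb, ← sum_Ico_consecutive _ (show 3 ≤ 4 by norm_num) hb4] at tail
  simp only [sum_Ico_succ_top, Nat.reduceLeDiff, Ico_self, sum_empty, zero_add] at tail
  have hrest := sum_tvNorm_Vk_mul_le (F := F) (G := G) (B := 0.8) h (by norm_num) (by norm_num)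
    (show 2 ≤ 4 by norm_num) b
  rw [← ht, mul_pow] at hrest
  have r4 : t ^ 4 ≤ 0.41 * t ^ 3 := by
    rw [pow_succ, mul_comm]
    gcongr
  have t3 : 0 ≤ t ^ 3 := by positivity
  norm_num at r4 hrest
  linarith

theorem tvNorm_sub_Wl_three_le (hn : 3 ≤ n) (hG : sm G = meanF F) :
    tvNorm ((∏ j, sm (F j)) - Wl F G 3) ≤ 82.2 * √(eta F G 1) ^ 4 := by
  have hn1 : 1 ≤ n := by omega
  set t := √(eta F G 1) with ht
  have ht0 : 0 ≤ t := Real.sqrt_nonneg _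
  have d2 := tvNorm_Vk_two_le hn1 hG
  have d3 := tvNorm_Vk_three_le hn1 hG
  rw [← ht] at d2 d3
  rcases le_total 0.41 t with h | h
  · have head := tvNorm_sub_Wl_le_head_of_mean hn1 hG (show 1 ≤ 3 by norm_num)
    simp only [sum_Ico_succ_top, Nat.reduceLeDiff, Ico_self, sum_empty, zero_add, Nat.reduceAdd] at head
    have h2 : 0.41 ^ 2 ≤ t ^ 2 := by gcongr
    have h3 : 0.41 * t ^ 2 ≤ t ^ 3 := by nlinarith [sq_nonneg t]
    have h4 : 0.41 * t ^ 3 ≤ t ^ 4 := by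
      have : 0 ≤ t ^ 3 := by positivity
      nlinarith
    linarith
  have tail := tvNorm_sub_Wl_le_tail F G hn 0
  have hrest := sum_tvNorm_Vk_mul_le (F := F) (G := G) (B := 0.8) h (by norm_num) (by norm_num)
    (show 2 ≤ 4 by norm_num) (n + 0 + 1)
  rw [← ht, mul_pow] at hrest
  have t4 : 0 ≤ t ^ 4 := by positivity
  refine tail.trans (hrest.trans ?_)
  norm_num
  linarith

end Upper

/-! ### The mean as a probability distribution. -/

section MeanMeasure

open Finset

variable {X : Type*} [MeasurableSpace X] {n : ℕ}

theorem exists_sm_eq_meanF [AddCommGroup X] [MeasurableSub₂ X] (hn : 1 ≤ n)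
    (F : Fin n → ProbabilityMeasure X) : ∃ G : ProbabilityMeasure X, sm G = meanF F := by
  have hn0 : (n : ENNReal) ≠ 0 := by exact_mod_cast (by omega : n ≠ 0)
  set μ : Measure X := (n : ENNReal)⁻¹ • ∑ j, (F j : Measure X) with hμ
  have hμ1 : IsProbabilityMeasure μ :=
    ⟨by simp [hμ, Measure.finsetSum_apply, ENNReal.inv_mul_cancel hn0]⟩
  obtain ⟨G, hG⟩ : ∃ G : ProbabilityMeasure X, (G : Measure X) = μ := ⟨⟨μ, hμ1⟩, rfl⟩
  refine ⟨G, ?_⟩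
  ext A hA
  have hsm : ∀ P : ProbabilityMeasure X, sm P A = (P : Measure X).real A := fun P =>
    Measure.toSignedMeasure_apply_measurable hA
  rw [hsm, meanF, smul_apply, hG]
  have e : (∑ j, sm (F j)) A = ∑ j, (F j : Measure X).real A := by
    have h : ∀ s : Finset (Fin n), (∑ j ∈ s, sm (F j)) A = ∑ j ∈ s, (F j : Measure X).real A := by
      intro s
      classical
      induction s using Finset.induction_on with
      | empty => rfl
      | insert a s ha ih =>
        rw [sum_insert ha, sum_insert ha, ← ih, ← hsm]
        rfl
    exact h Finset.univ
  rw [e]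
  simp [hμ, measureReal_def, Measure.finsetSum_apply, ENNReal.toReal_sum]

end MeanMeasure

/-! ### Examples with nonzero error on a group of order two. -/

section NonvanishingExample

open Finset

/-- From `w² = 1` follows `(1 - w)² = 2 (1 - w)`, so powers of `1 - w` are positive multiples of it.
-/
theorem one_sub_pow_ne_zero {R : Type*} [CommRing R] [Algebra ℝ R] {w : R} (hw : w * w = 1)
    (h : w ≠ 1) (k : ℕ) : (1 - w) ^ (k + 1) ≠ 0 := by
  have e : (1 - w) ^ (k + 1) = ((2 : ℝ) ^ k) • (1 - w) := by
    induction k with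
    | zero => simp
    | succ k ih =>
      rw [pow_succ, ih, smul_mul_assoc, pow_succ, mul_smul]
      congr 1
      rw [two_smul]
      linear_combination hw
  rw [e]
  exact smul_ne_zero (by positivity) (sub_ne_zero.2 (Ne.symm h))

/-- For the family `1, w, …, w` the deviations from the mean are `l/(l+1)` times and `-1/(l+1)`
times `1 - w`, so their product is a nonzero multiple of `(1 - w)^(l+1)`. -/
theorem prod_sub_mean_ne_zero {R : Type*} [CommRing R] [Algebra ℝ R] {w : R} (hw : w * w = 1)
    (h : w ≠ 1) {l : ℕ} (hl : 1 ≤ l) {f : Fin (l + 1) → R} (h0 : f 0 = 1)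
    (hs : ∀ j : Fin l, f j.succ = w) :
    ∏ j, (f j - ((l + 1 : ℕ) : ℝ)⁻¹ • ∑ i, f i) ≠ 0 := by
  have hl0 : (l : ℝ) ≠ 0 := by positivity
  have hl1 : ((l + 1 : ℕ) : ℝ) ≠ 0 := by positivity
  have e : ∑ i, f i = 1 + (l : ℝ) • w := by
    rw [Fin.sum_univ_succ, h0, sum_congr rfl fun j _ => hs j, sum_const, card_univ,
      Fintype.card_fin, ← Nat.cast_smul_eq_nsmul ℝ]
  have key : ∀ a : R, ∀ c : ℝ, ((l + 1 : ℕ) : ℝ) • a - (1 + (l : ℝ) • w) = c • (1 - w) →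
      a - ((l + 1 : ℕ) : ℝ)⁻¹ • ∑ i, f i = (((l + 1 : ℕ) : ℝ)⁻¹ * c) • (1 - w) := by
    intro a c hc
    rw [mul_smul, ← hc, smul_sub, smul_smul, inv_mul_cancel₀ hl1, one_smul, e]
  have k0 := key 1 l (by push_cast; module)
  have k1 := key w (-1) (by push_cast; module)
  rw [Fin.prod_univ_succ, h0, prod_congr rfl fun j _ => by rw [hs j], prod_const, card_univ,
    Fintype.card_fin, k0, k1, smul_pow, smul_mul_smul_comm, ← pow_succ']
  refine smul_ne_zero ?_ (one_sub_pow_ne_zero hw h l)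
  have := inv_ne_zero hl1
  exact mul_ne_zero (mul_ne_zero this hl0) (pow_ne_zero _ (mul_ne_zero this (by norm_num)))

theorem toSignedMeasure_mul {X : Type*} [AddCommGroup X] [MeasurableSpace X] [MeasurableSub₂ X]
    (μ ν : Measure X) [IsFiniteMeasure μ] [IsFiniteMeasure ν] :
    μ.toSignedMeasure * ν.toSignedMeasure = (μ.conv ν).toSignedMeasure := by
  have := measurableAdd₂_of_sub X
  have hz : ∀ ρ : Measure X, ∀ [IsFiniteMeasure ρ], convPos (0 : Measure X) ρ = 0 := by
    intro ρ _
    unfold convPos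
    rw [← Measure.toSignedMeasure_zero]
    exact Measure.toSignedMeasure_congr (Measure.zero_conv ρ)
  have h := conv_sub_sub μ 0 ν 0
  rw [Measure.toSignedMeasure_zero, sub_zero, sub_zero, convPos_comm μ 0, hz, hz, hz, sub_zero,
    sub_zero, add_zero] at h
  exact h

/-- A Dirac measure of order two in the convolution algebra. -/
theorem exists_sm_mul_self_eq_one : ∃ (P Q : ProbabilityMeasure (ULift.{v} (ZMod 2))),
    sm P = 1 ∧ sm Q * sm Q = 1 ∧ sm Q ≠ 1 := by
  have := measurableAdd₂_of_sub (ULift.{v} (ZMod 2))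
  set a : ULift.{v} (ZMod 2) := ⟨1⟩ with ha
  have haa : a + a = 0 := by
    apply ULift.down_injective
    decide
  have ha0 : a ≠ 0 := fun h => absurd (congrArg ULift.down h) (by decide)
  refine ⟨⟨Measure.dirac 0, inferInstance⟩, ⟨Measure.dirac a, inferInstance⟩, rfl, ?_, fun h => ?_⟩
  · refine (toSignedMeasure_mul (Measure.dirac a) (Measure.dirac a)).trans ?_
    refine Measure.toSignedMeasure_congr ?_
    rw [Measure.dirac_conv_dirac, haa]
  · have h' : (Measure.dirac a).toSignedMeasure {a} = (Measure.dirac (0 : ULift.{v} (ZMod 2))).toSignedMeasure {a} :=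
      congrArg (fun V : SignedMeasure (ULift.{v} (ZMod 2)) => V {a}) h
    rw [Measure.toSignedMeasure_apply_measurable (measurableSet_singleton a),
      Measure.toSignedMeasure_apply_measurable (measurableSet_singleton a)] at h'
    simp [measureReal_def, ha0.symm] at h'

section

variable {X : Type*} [AddCommGroup X] [MeasurableSpace X] [MeasurableSub₂ X]

/-- For `n = l + 1` the error is the single term `V_n`, the product of all differences. -/
theorem tvNorm_prod_sub_Wl_pos {l : ℕ} (F : Fin (l + 1) → ProbabilityMeasure X)
    (G : ProbabilityMeasure X) (h : ∏ j, (sm (F j) - sm G) ≠ 0) :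
    0 < tvNorm ((∏ j, sm (F j)) - Wl F G l) := by
  refine lt_of_le_of_ne (tvNorm_nonneg _) fun h0 => h ?_
  have h1 := eq_zero_of_tvNorm_eq_zero h0.symm
  rw [prod_sm_sub_Wl F G (Nat.le_succ l), Nat.Ico_succ_singleton, sum_singleton, Nat.sub_self,
    pow_zero, mul_one] at h1
  rw [← h1, Vk]
  have : (Finset.univ : Finset (Fin (l + 1))).powersetCard (l + 1) = {Finset.univ} := by
    have h2 := powersetCard_self (Finset.univ : Finset (Fin (l + 1)))
    rwa [card_univ, Fintype.card_fin] at h2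
  rw [this, sum_singleton]

end

theorem exists_tvNorm_pos (l : ℕ) : ∃ (F : Fin (l + 1) → ProbabilityMeasure (ULift.{v} (ZMod 2)))
    (G : ProbabilityMeasure (ULift.{v} (ZMod 2))), 0 < tvNorm ((∏ j, sm (F j)) - Wl F G l) := by
  obtain ⟨P, Q, hP, hQ, hQ1⟩ := exists_sm_mul_self_eq_one.{v}
  refine ⟨fun _ => P, Q, tvNorm_prod_sub_Wl_pos _ _ ?_⟩
  rw [prod_const, card_univ, Fintype.card_fin, hP]
  exact one_sub_pow_ne_zero hQ hQ1 l

theorem exists_tvNorm_pos_of_mean {l : ℕ} (hl : 1 ≤ l) :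
    ∃ (F : Fin (l + 1) → ProbabilityMeasure (ULift.{v} (ZMod 2)))
      (G : ProbabilityMeasure (ULift.{v} (ZMod 2))), sm G = meanF F ∧
        0 < tvNorm ((∏ j, sm (F j)) - Wl F G l) := by
  obtain ⟨P, Q, hP, hQ, hQ1⟩ := exists_sm_mul_self_eq_one.{v}
  obtain ⟨G, hG⟩ := exists_sm_eq_meanF (n := l + 1) (by omega) (Fin.cons P fun _ => Q)
  refine ⟨_, G, hG, tvNorm_prod_sub_Wl_pos _ _ ?_⟩
  rw [hG]
  exact prod_sub_mean_ne_zero hQ hQ1 hl (f := fun j => sm ((Fin.cons P fun _ => Q : Fin (l + 1) → _) j))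
    hP fun j => rfl

end NonvanishingExample

/-! ### Existence, positivity and numerical bounds of the smallest constants. -/

section OptimalConstants

theorem le_sInf_mul {S : Set ℝ} (hS : S.Nonempty) {D E : ℝ} (hE : 0 ≤ E)
    (h : ∀ u ∈ S, D ≤ u * E) : D ≤ sInf S * E := by
  rcases hE.eq_or_lt with rfl | hE
  · obtain ⟨u, hu⟩ := hS
    simpa using h u hu
  · rw [← div_le_iff₀ hE]
    exact le_csInf hS fun u hu => (div_le_iff₀ hE).2 (h u hu)

theorem bddBelow_of_forall_pos {S : Set ℝ} (h : ∀ u ∈ S, 0 < u) : BddBelow S :=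
  ⟨0, fun u hu => (h u hu).le⟩

/-- The inequalities pass to the infimum. Positivity does not, and comes from an instance with
nonzero error. -/
theorem isLeast_admissible {l : ℕ} (hne : (admissible.{v} l).Nonempty) :
    IsLeast (admissible.{v} l) (uConst.{v} l) := by
  have hE : ∀ (X : Type v) [AddCommGroup X] [MeasurableSpace X] [MeasurableSub₂ X] (n : ℕ)
      (F : Fin n → ProbabilityMeasure X) (G : ProbabilityMeasure X),
      0 ≤ eta F G 0 ^ (((l : ℝ) + 1) / 2) :=
    fun X _ _ _ n F G => Real.rpow_nonneg (eta_nonneg F G 0) _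
  have key : ∀ (X : Type v) [AddCommGroup X] [MeasurableSpace X] [MeasurableSub₂ X] (n : ℕ),
      1 ≤ n → l ≤ n → ∀ (F : Fin n → ProbabilityMeasure X) (G : ProbabilityMeasure X),
      tvNorm ((∏ j, sm (F j)) - Wl F G l) ≤ uConst.{v} l * eta F G 0 ^ (((l : ℝ) + 1) / 2) :=
    fun X _ _ _ n hn hl F G => le_sInf_mul hne (hE X n F G) fun u hu => hu.2 X n hn hl F G
  refine ⟨⟨?_, key⟩, fun u hu => csInf_le (bddBelow_of_forall_pos fun u hu => hu.1) hu⟩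
  obtain ⟨F, G, h⟩ := exists_tvNorm_pos.{v} l
  exact pos_of_mul_pos_left (h.trans_le (key _ _ (by omega) (by omega) F G)) (hE _ _ F G)

theorem isLeast_admissibleMean {l : ℕ} (hl : 1 ≤ l) (hne : (admissibleMean.{v} l).Nonempty) :
    IsLeast (admissibleMean.{v} l) (uTilde.{v} l) := by
  have hE : ∀ (X : Type v) [AddCommGroup X] [MeasurableSpace X] [MeasurableSub₂ X] (n : ℕ)
      (F : Fin n → ProbabilityMeasure X) (G : ProbabilityMeasure X),
      0 ≤ eta F G 1 ^ (((l : ℝ) + 1) / 2) :=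
    fun X _ _ _ n F G => Real.rpow_nonneg (eta_nonneg F G 1) _
  have key : ∀ (X : Type v) [AddCommGroup X] [MeasurableSpace X] [MeasurableSub₂ X] (n : ℕ),
      1 ≤ n → l ≤ n → ∀ (F : Fin n → ProbabilityMeasure X) (G : ProbabilityMeasure X),
      sm G = meanF F →
      tvNorm ((∏ j, sm (F j)) - Wl F G l) ≤ uTilde.{v} l * eta F G 1 ^ (((l : ℝ) + 1) / 2) :=
    fun X _ _ _ n hn hl F G hG => le_sInf_mul hne (hE X n F G) fun u hu => hu.2 X n hn hl F G hG
  refine ⟨⟨?_, key⟩, fun u hu => csInf_le (bddBelow_of_forall_pos fun u hu => hu.1) hu⟩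
  obtain ⟨F, G, hG, h⟩ := exists_tvNorm_pos_of_mean.{v} hl
  exact pos_of_mul_pos_left (h.trans_le (key _ _ (by omega) (by omega) F G hG)) (hE _ _ F G)

theorem rpow_half_eq_sqrt_pow {C : ℝ} (hC : 0 ≤ C) (l : ℕ) :
    C ^ (((l : ℝ) + 1) / 2) = √C ^ (l + 1) := by
  rw [Real.sqrt_eq_rpow, ← Real.rpow_natCast, ← Real.rpow_mul hC]
  congr 1
  push_cast
  ring

theorem mem_admissible {l : ℕ} {x : ℝ} (hx : 0 < x) (hx1 : x < 1)
    (hxl : x ^ (l + 1) + x / 2 = 1) :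
    (2 * Real.exp 1 * c₁) ^ (((l : ℝ) + 1) / 2) / (1 - x) ∈ admissible.{v} l := by
  refine ⟨div_pos (Real.rpow_pos_of_pos two_mul_exp_mul_c₁_pos _) (by linarith), ?_⟩
  intro X _ _ _ n _ hl F G
  refine (tvNorm_sub_Wl_le F G hl hx hx1 hxl).trans (le_of_eq ?_)
  rw [eta_rpow, rpow_half_eq_sqrt_pow two_mul_exp_mul_c₁_pos.le, mul_pow]
  ring

theorem mem_admissibleMean {l : ℕ} (hl : 1 ≤ l) {x : ℝ} (hx : 0 < x) (hx1 : x < 1)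
    (hxl : x ^ (l + 1) - x ^ 2 / 2 + x = 1) :
    (2 * Real.exp 1 * c₁) ^ (((l : ℝ) + 1) / 2) / (1 - x) ∈ admissibleMean.{v} l := by
  refine ⟨div_pos (Real.rpow_pos_of_pos two_mul_exp_mul_c₁_pos _) (by linarith), ?_⟩
  intro X _ _ _ n hn hln F G hG
  refine (tvNorm_sub_Wl_le_of_mean hn hG hl hln hx hx1 hxl).trans (le_of_eq ?_)
  rw [eta_rpow, rpow_half_eq_sqrt_pow two_mul_exp_mul_c₁_pos.le, mul_pow]
  ring

theorem uConst_le {l : ℕ} {u : ℝ} (hu : u ∈ admissible.{v} l) : uConst.{v} l ≤ u :=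
  csInf_le (bddBelow_of_forall_pos fun _ h => h.1) hu

theorem uTilde_le {l : ℕ} {u : ℝ} (hu : u ∈ admissibleMean.{v} l) : uTilde.{v} l ≤ u :=
  csInf_le (bddBelow_of_forall_pos fun _ h => h.1) hu

/-- A rational `q` above the root `x` suffices, because `1/(1 - x)` increases with `x`. -/
theorem uConst_le_of_root {l : ℕ} {q u : ℝ} (hq0 : 0 ≤ q) (hq : q < 1) (hql : 1 ≤ q ^ (l + 1) + q / 2)
    (hu : 1.94271 ^ (l + 1) ≤ u * (1 - q)) : uConst.{v} l ≤ u := by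
  obtain ⟨x, hx, hx1, hxl, -⟩ := exists_unique_root_linear l
  have hxq : x ≤ q := by
    by_contra! h
    have : q ^ (l + 1) ≤ x ^ (l + 1) := by gcongr
    linarith
  refine (uConst_le (mem_admissible hx hx1 hxl)).trans ?_
  rw [rpow_half_eq_sqrt_pow two_mul_exp_mul_c₁_pos.le]
  have h1 := sqrt_two_mul_exp_mul_c₁_le
  have h2 : √(2 * Real.exp 1 * c₁) ^ (l + 1) ≤ 1.94271 ^ (l + 1) := by gcongr
  have hq' : 0 < 1 - q := by linarith
  calc _ ≤ 1.94271 ^ (l + 1) / (1 - q) := by gcongr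
    _ ≤ u := by rwa [div_le_iff₀ hq']

theorem uConst_zero_le : uConst.{v} 0 ≤ 5.9 :=
  uConst_le_of_root (q := 0.6667) (by norm_num) (by norm_num) (by norm_num) (by norm_num)

theorem uConst_one_le : uConst.{v} 1 ≤ 17.3 :=
  uConst_le_of_root (q := 0.7808) (by norm_num) (by norm_num) (by norm_num) (by norm_num)

theorem uConst_two_le : uConst.{v} 2 ≤ 44.5 :=
  uConst_le_of_root (q := 0.83513) (by norm_num) (by norm_num) (by norm_num) (by norm_num)

theorem uConst_three_le : uConst.{v} 3 ≤ 107.5 :=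
  uConst_le_of_root (q := 0.86748) (by norm_num) (by norm_num) (by norm_num) (by norm_num)

theorem uTilde_one_le : uTilde.{v} 1 ≤ 10.94 := by
  refine uTilde_le ⟨by norm_num, fun X _ _ _ n hn _ F G hG => ?_⟩
  rw [eta_rpow]
  exact tvNorm_sub_Wl_one_le hn hG

theorem uTilde_two_le : uTilde.{v} 2 ≤ 31.5 := by
  refine uTilde_le ⟨by norm_num, fun X _ _ _ n _ hn F G hG => ?_⟩
  rw [eta_rpow]
  exact tvNorm_sub_Wl_two_le hn hG

theorem uTilde_three_le : uTilde.{v} 3 ≤ 82.2 := by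
  refine uTilde_le ⟨by norm_num, fun X _ _ _ n _ hn F G hG => ?_⟩
  rw [eta_rpow]
  exact tvNorm_sub_Wl_three_le hn hG

end OptimalConstants

/-! ### Smoothing by powers of a mixture. -/

section Smoothness

open Finset

variable {R κ : Type*} [CommRing R] [Algebra ℝ R] {p : Seminorm ℝ R} [Fintype κ]

/-- With `g = ∑ q_r h_r` and `a = ∑ q_r x_r h_r` for a centred `x`, both `g^N` and its derivative
`N a g^(N-1)` in direction `a` are mixtures of elements of the unit ball; the density `S` of the
second with respect to the first has variance `N ∑ q_r x_r²`. -/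
theorem exists_mixture_pow (h1 : p 1 ≤ 1) (hmul : ∀ a b, p (a * b) ≤ p a * p b) {h : κ → R}
    (hh : ∀ r, p (h r) ≤ 1) {q x : κ → ℝ} (hq : ∀ r, 0 ≤ q r) (hq1 : ∑ r, q r = 1)
    (hx : ∑ r, q r * x r = 0) (N : ℕ) :
    ∃ (s : Finset (Fin N → κ)) (w S : (Fin N → κ) → ℝ) (B : (Fin N → κ) → R),
      (∀ i ∈ s, 0 ≤ w i) ∧ (∀ i ∈ s, p (B i) ≤ 1) ∧ ∑ i ∈ s, w i = 1 ∧ ∑ i ∈ s, w i * S i = 0 ∧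
      ∑ i ∈ s, w i * S i ^ 2 = N * ∑ r, q r * x r ^ 2 ∧
      (∑ r, q r • h r) ^ N = ∑ i ∈ s, w i • B i ∧
      (N : ℝ) • ((∑ r, (q r * x r) • h r) * (∑ r, q r • h r) ^ (N - 1)) =
        ∑ i ∈ s, (w i * S i) • B i := by
  classical
  induction N with
  | zero =>
    refine ⟨{fun i => i.elim0}, fun _ => 1, fun _ => 0, fun _ => 1, ?_, ?_, ?_, ?_, ?_, ?_, ?_⟩ <;>
      simp [h1]
  | succ N ih =>
    obtain ⟨s, w, S, B, hw, hB, hw1, hS, hS2, hU, hV⟩ := ih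
    -- A new independent coordinate is prepended: weights and elements multiply, while the densities
    -- add. Since both summands are centred, their variances add as well.
    refine ⟨(Finset.univ ×ˢ s).map (Fin.consEquiv fun _ => κ).toEmbedding,
      fun i => q (i 0) * w (Fin.tail i), fun i => x (i 0) + S (Fin.tail i),
      fun i => h (i 0) * B (Fin.tail i), ?_, ?_, ?_, ?_, ?_, ?_, ?_⟩
    · intro i hi
      rw [mem_map] at hi
      obtain ⟨⟨r, i⟩, hi, rfl⟩ := hi
      simpa [Fin.consEquiv] using mul_nonneg (hq r) (hw i (mem_product.1 hi).2)
    · intro i hi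
      rw [mem_map] at hi
      obtain ⟨⟨r, i⟩, hi, rfl⟩ := hi
      simpa [Fin.consEquiv] using (hmul _ _).trans
        (mul_le_one₀ (hh r) (apply_nonneg p _) (hB i (mem_product.1 hi).2))
    all_goals
      rw [sum_map, sum_product]
      simp only [Fin.consEquiv, Equiv.toEmbedding_apply, Equiv.coe_fn_mk, Fin.cons_zero,
        Fin.tail_cons]
    · simp only [← mul_sum, hw1, mul_one, hq1]
    · have e : ∀ r, ∑ i ∈ s, q r * w i * (x r + S i) =
          q r * x r * ∑ i ∈ s, w i + q r * ∑ i ∈ s, w i * S i := by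
        intro r
        rw [mul_sum, mul_sum, ← sum_add_distrib]
        exact sum_congr rfl fun i _ => by ring
      simp only [e, hw1, hS, mul_one, mul_zero, add_zero, hx]
    · have e : ∀ r, ∑ i ∈ s, q r * w i * (x r + S i) ^ 2 =
          q r * x r ^ 2 * ∑ i ∈ s, w i + 2 * (q r * x r) * ∑ i ∈ s, w i * S i
            + q r * ∑ i ∈ s, w i * S i ^ 2 := by
        intro r
        rw [mul_sum, mul_sum, mul_sum, ← sum_add_distrib, ← sum_add_distrib]
        exact sum_congr rfl fun i _ => by ring
      simp only [e, hw1, hS, hS2, mul_one, mul_zero, add_zero, sum_add_distrib, ← sum_mul, hq1]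
      push_cast
      ring
    · rw [pow_succ', hU, sum_mul_sum]
      exact sum_congr rfl fun r _ => sum_congr rfl fun i _ => smul_mul_smul_comm _ _ _ _
    · have e : ∑ r, ∑ i ∈ s, (q r * w i * (x r + S i)) • (h r * B i) =
          (∑ r, (q r * x r) • h r) * ∑ i ∈ s, w i • B i
            + (∑ r, q r • h r) * ∑ i ∈ s, (w i * S i) • B i := by
        rw [sum_mul_sum, sum_mul_sum, ← sum_add_distrib]
        refine sum_congr rfl fun r _ => ?_
        rw [← sum_add_distrib]
        refine sum_congr rfl fun i _ => ?_
        rw [smul_mul_smul_comm, smul_mul_smul_comm, ← add_smul]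
        congr 1
        ring
      rw [e, ← hU, ← hV]
      -- The exponent `N - 1` is truncated at `N = 0`, where its coefficient vanishes.
      rcases N with _ | N
      · simp
      · rw [mul_smul_comm, Nat.add_sub_cancel, Nat.add_sub_cancel, mul_left_comm, ← pow_succ']
        push_cast
        module

/-- Take `x_r = δ_r / q_r` and `N = m + 1` in the mixture representation. Then `(m+1)` times the
seminorm is at most the mean of `|S|`, and Cauchy–Schwarz bounds this by the standard deviation, of
order `√(m+1)`. -/
theorem seminorm_mul_pow_sq_le (h1 : p 1 ≤ 1) (hmul : ∀ a b, p (a * b) ≤ p a * p b) {h : κ → R}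
    (hh : ∀ r, p (h r) ≤ 1) {q δ : κ → ℝ} (hq : ∀ r, 0 < q r) (hq1 : ∑ r, q r = 1)
    (hδ : ∑ r, δ r = 0) (m : ℕ) :
    p ((∑ r, δ r • h r) * (∑ r, q r • h r) ^ m) ^ 2 ≤ (∑ r, δ r ^ 2 / q r) / (m + 1) := by
  have hqδ : ∀ r, q r * (δ r / q r) = δ r := fun r => mul_div_cancel₀ _ (hq r).ne'
  obtain ⟨s, w, S, B, hw, hB, hw1, -, hS2, -, hV⟩ := exists_mixture_pow h1 hmul hh
    (fun r => (hq r).le) hq1 (x := fun r => δ r / q r) (by simpa only [hqδ] using hδ) (m + 1)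
  simp only [hqδ] at hV
  rw [Nat.add_sub_cancel] at hV
  set T := p ((∑ r, δ r • h r) * (∑ r, q r • h r) ^ m) with hT
  have hm : (0 : ℝ) < ((m + 1 : ℕ) : ℝ) := by positivity
  have b1 : ((m + 1 : ℕ) : ℝ) * T ≤ ∑ i ∈ s, w i * |S i| := by
    rw [hT, ← Real.norm_of_nonneg hm.le, ← map_smul_eq_mul, hV]
    refine (seminorm_sum_le _ _).trans (sum_le_sum fun i hi => ?_)
    rw [map_smul_eq_mul, norm_mul, Real.norm_of_nonneg (hw i hi), Real.norm_eq_abs]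
    exact mul_le_of_le_one_right (mul_nonneg (hw i hi) (abs_nonneg _)) (hB i hi)
  have b2 : (∑ i ∈ s, w i * |S i|) ^ 2 ≤ ∑ i ∈ s, w i * S i ^ 2 := by
    have cs := sum_sq_le_sum_mul_sum_of_sq_le_mul s hw
      (fun i hi => mul_nonneg (hw i hi) (sq_nonneg (S i)))
      (r := fun i => w i * |S i|) fun i _ => le_of_eq (by rw [mul_pow, sq_abs]; ring)
    rwa [hw1, one_mul] at cs
  have b3 : ∑ r, q r * (δ r / q r) ^ 2 = ∑ r, δ r ^ 2 / q r :=
    sum_congr rfl fun r _ => by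
      have := (hq r).ne'
      field_simp
  rw [hS2, b3] at b2
  have hT0 : 0 ≤ T := apply_nonneg p _
  have b4 := (pow_le_pow_left₀ (by positivity) b1 2).trans b2
  push_cast at b4 hm
  rw [le_div_iff₀ hm]
  have : (m + 1 : ℝ) * (T ^ 2 * (m + 1)) ≤ (m + 1) * ∑ r, δ r ^ 2 / q r := by linarith
  exact le_of_mul_le_mul_left this hm

/-- Since `δ_0 = -∑_{r≥1} δ_r`, Cauchy–Schwarz gives `δ_0² ≤ (1 - q_0) ∑_{r≥1} δ_r²/q_r`; the sum is
then bounded using `1 + (1 - q_0)/q_0 = 1/q_0`. -/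
theorem sum_sq_div_le {d : ℕ} {q δ : Fin (d + 1) → ℝ} (hq : ∀ r, 0 < q r) (hq1 : ∑ r, q r = 1)
    (hδ : ∑ r, δ r = 0) :
    ∑ r, δ r ^ 2 / q r ≤ ∑ r : Fin d, δ r.succ ^ 2 / (q r.succ * q 0) := by
  rw [Fin.sum_univ_succ] at hq1 hδ ⊢
  have h0 := hq 0
  have cs : (∑ r : Fin d, δ r.succ) ^ 2 ≤
      (∑ r : Fin d, q r.succ) * ∑ r : Fin d, δ r.succ ^ 2 / q r.succ :=
    sum_sq_le_sum_mul_sum_of_sq_le_mul _ (fun r _ => (hq _).le)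
      (fun r _ => div_nonneg (sq_nonneg _) (hq _).le)
      fun r _ => (mul_div_cancel₀ _ (hq _).ne').ge
  have e : ∑ r : Fin d, δ r.succ ^ 2 / (q r.succ * q 0) =
      (∑ r : Fin d, δ r.succ ^ 2 / q r.succ) / q 0 := by
    rw [sum_div]
    exact sum_congr rfl fun r _ => (div_div _ _ _).symm
  have e0 : δ 0 ^ 2 = (∑ r : Fin d, δ r.succ) ^ 2 := by
    rw [eq_neg_of_add_eq_zero_left hδ, neg_sq]
  have e1 : ∑ r : Fin d, q r.succ = 1 - q 0 := by linarith
  rw [e, e0, le_div_iff₀ h0, add_mul, div_mul_cancel₀ _ h0.ne']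
  rw [e1] at cs
  linarith

end Smoothness

/-! ### Linear bookkeeping for mixtures. -/

section ModuleSums

open Finset

variable {R ι κ : Type*} [AddCommGroup R] [Module ℝ R] [Fintype ι] [Fintype κ]

theorem smul_sum_sum_eq (c : ℝ) (q : ι → κ → ℝ) (h : κ → R) (qbar : κ → ℝ)
    (hq : ∀ r, qbar r = c * ∑ j, q j r) :
    c • ∑ j, ∑ r, q j r • h r = ∑ r, qbar r • h r := by
  rw [sum_comm, smul_sum]
  refine sum_congr rfl fun r _ => ?_
  rw [hq, mul_smul, sum_smul]

theorem sum_smul_sub_sum_smul (a b : κ → ℝ) (h : κ → R) :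
    ∑ r, a r • h r - ∑ r, b r • h r = ∑ r, (a r - b r) • h r := by
  rw [← sum_sub_distrib]
  exact sum_congr rfl fun r _ => (sub_smul _ _ _).symm

end ModuleSums

/-! ### The multinomial approximation. -/

section Multinomial

open Finset

variable {X : Type*} [AddCommGroup X] [MeasurableSpace X] [MeasurableSub₂ X] {n d : ℕ}

theorem eta_one_le_of_mixture (hn : 1 ≤ n) {H : Fin (d + 1) → ProbabilityMeasure X}
    {F : Fin n → ProbabilityMeasure X} {G : ProbabilityMeasure X} (hG : sm G = meanF F)
    {q : Fin n → Fin (d + 1) → ℝ} {qbar : Fin (d + 1) → ℝ} (hq1 : ∀ j, ∑ r, q j r = 1)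
    (hqbar : ∀ r, qbar r = (n : ℝ)⁻¹ * ∑ j, q j r) (hpos : ∀ r, 0 < qbar r)
    (hF : ∀ j, sm (F j) = ∑ r, q j r • sm (H r)) :
    eta F G 1 ≤
      2 * ∑ r : Fin d, ∑ j, (qbar r.succ - q j r.succ) ^ 2 / (n * qbar r.succ * qbar 0) := by
  have hn0 : (0 : ℝ) < n := by exact_mod_cast hn
  have hGH : sm G = ∑ r, qbar r • sm (H r) := by
    rw [hG, meanF, sum_congr rfl fun j _ => hF j]
    exact smul_sum_sum_eq _ _ _ _ hqbar
  have hbar1 : ∑ r, qbar r = 1 := by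
    rw [sum_congr rfl fun r _ => hqbar r, ← mul_sum, sum_comm, sum_congr rfl fun j _ => hq1 j]
    simp [hn0.ne']
  have hnonneg : 0 ≤ ∑ r : Fin d, ∑ j, (qbar r.succ - q j r.succ) ^ 2 / (n * qbar r.succ * qbar 0) :=
    sum_nonneg fun r _ => sum_nonneg fun j _ =>
      div_nonneg (sq_nonneg _) (mul_nonneg (mul_nonneg hn0.le (hpos _).le) (hpos _).le)
  -- For `n = 1` the supremum is over the empty set and equals `0`, so the bound itself must be
  -- nonnegative.
  refine Real.sSup_le ?_ (mul_nonneg zero_le_two hnonneg)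
  rintro _ ⟨k, hk, rfl⟩
  have hk' := Finset.mem_Icc.1 (Finset.mem_coe.1 hk)
  have hk0 : (0 : ℝ) < k := by
    have : 0 < k := by omega
    exact_mod_cast this
  have hzero : nuTilde F G k = 0 := by
    rw [nuTilde, sum_Mjk_eq_zero hn hG, tvNorm_zero]
  have hterm : ∀ j, tvNorm (Mjk F G j k) ^ 2 ≤
      (∑ r : Fin d, (qbar r.succ - q j r.succ) ^ 2 / (qbar r.succ * qbar 0)) /
        (((n - k) / k : ℕ) + 1) := by
    intro j
    have hM : Mjk F G j k = (∑ r, (q j r - qbar r) • sm (H r)) *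
        (∑ r, qbar r • sm (H r)) ^ ((n - k) / k) := by
      rw [Mjk, hGH, hF j]
      exact congrArg (· * _) (sum_smul_sub_sum_smul _ _ _)
    have hδ : ∑ r, (q j r - qbar r) = 0 := by rw [sum_sub_distrib, hq1, hbar1, sub_self]
    rw [hM]
    refine (seminorm_mul_pow_sq_le (p := tvSeminorm X) tvSeminorm_one_le tvSeminorm_mul_le
      (fun r => tvNorm_sm (H r)) hpos hbar1 hδ _).trans ?_
    refine div_le_div_of_nonneg_right ?_ (by positivity)
    refine (sum_sq_div_le hpos hbar1 hδ).trans (le_of_eq ?_)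
    exact sum_congr rfl fun r _ => by rw [sub_sq_comm]
  -- Here `⌊(n-k)/k⌋ + 1 = ⌊n/k⌋ ≥ 1`, so `n < k (⌊n/k⌋ + 1) ≤ 2k ⌊n/k⌋`; this is the origin of the
  -- factor `2`.
  have hfloor : (n : ℝ) ≤ 2 * (k * (((n - k) / k : ℕ) + 1)) := by
    have : n ≤ 2 * (k * ((n - k) / k + 1)) := by
      have h1 := Nat.div_add_mod (n - k) k
      have h2 := Nat.mod_lt (n - k) (show 0 < k by omega)
      have h3 : k * ((n - k) / k + 1) = k * ((n - k) / k) + k := by ring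
      omega
    exact_mod_cast this
  change (1 / (k : ℝ)) * (nuTilde F G k ^ 2 / (4 * c₁) + nu F G k 2) ≤ _
  rw [hzero, one_div, inv_mul_le_iff₀ hk0]
  have hnu : nu F G k 2 ≤ ∑ j, (∑ r : Fin d, (qbar r.succ - q j r.succ) ^ 2 /
      (qbar r.succ * qbar 0)) / (((n - k) / k : ℕ) + 1) := sum_le_sum fun j _ => hterm j
  have e : ∑ r : Fin d, ∑ j, (qbar r.succ - q j r.succ) ^ 2 / (n * qbar r.succ * qbar 0) =
      (∑ j, ∑ r : Fin d, (qbar r.succ - q j r.succ) ^ 2 / (qbar r.succ * qbar 0)) / n := by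
    rw [sum_comm, sum_div]
    refine sum_congr rfl fun j _ => ?_
    rw [sum_div]
    refine sum_congr rfl fun r _ => ?_
    rw [div_div]
    ring_nf
  rw [← sum_div] at hnu
  rw [e] at hnonneg ⊢
  set Q := ∑ j, ∑ r : Fin d, (qbar r.succ - q j r.succ) ^ 2 / (qbar r.succ * qbar 0) with hQ
  have hQ0 : 0 ≤ Q := by
    have := mul_nonneg hnonneg hn0.le
    rwa [div_mul_cancel₀ _ hn0.ne'] at this
  have hm1 : (0 : ℝ) < ((n - k) / k : ℕ) + 1 := by positivity
  have hfin : Q / (((n - k) / k : ℕ) + 1) ≤ k * (2 * (Q / n)) := by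
    rw [div_le_iff₀ hm1]
    have e2 : k * (2 * (Q / n)) * (((n - k) / k : ℕ) + 1) =
        Q * (2 * (k * (((n - k) / k : ℕ) + 1))) / n := by ring
    rw [e2, le_div_iff₀ hn0]
    gcongr
  refine le_trans (le_of_eq ?_) (hnu.trans hfin)
  simp

theorem Wl_one_of_mean (hn : 1 ≤ n) {F : Fin n → ProbabilityMeasure X} {G : ProbabilityMeasure X}
    (hG : sm G = meanF F) : Wl F G 1 = meanF F ^ n := by
  have h : Wl F G 1 = Vk F G 0 * sm G ^ (n - 0) + Vk F G 1 * sm G ^ (n - 1) := by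
    rw [Wl, sum_range_succ, sum_range_one]
  have h0 : Vk F G 0 = 1 := by rw [Vk, powersetCard_zero, sum_singleton, prod_empty]
  rw [h, Vk_one_eq_zero hn hG, h0, one_mul, Nat.sub_zero, hG]
  exact add_zero _

theorem tvNorm_prod_sub_meanF_pow_le {u : ℝ} (hu : u ∈ admissibleMean.{v} 1) {X : Type v}
    [AddCommGroup X] [MeasurableSpace X] [MeasurableSub₂ X] (hn : 1 ≤ n)
    {H : Fin (d + 1) → ProbabilityMeasure X} {F : Fin n → ProbabilityMeasure X}
    {q : Fin n → Fin (d + 1) → ℝ} {qbar : Fin (d + 1) → ℝ} (hq1 : ∀ j, ∑ r, q j r = 1)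
    (hqbar : ∀ r, qbar r = (n : ℝ)⁻¹ * ∑ j, q j r) (hpos : ∀ r, 0 < qbar r)
    (hF : ∀ j, sm (F j) = ∑ r, q j r • sm (H r)) :
    tvNorm ((∏ j, sm (F j)) - meanF F ^ n) ≤
      2 * u * ∑ r : Fin d, ∑ j, (qbar r.succ - q j r.succ) ^ 2 / (n * qbar r.succ * qbar 0) := by
  obtain ⟨G, hG⟩ := exists_sm_eq_meanF hn F
  have h := hu.2 X n hn hn F G hG
  -- For `ℓ = 1` the exponent `(ℓ+1)/2` is one, so the bound is linear in `η₁`.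
  rw [Wl_one_of_mean hn hG, Nat.cast_one, one_add_one_eq_two, div_self two_ne_zero,
    Real.rpow_one] at h
  have h2 := mul_le_mul_of_nonneg_left (eta_one_le_of_mixture hn hG hq1 hqbar hpos hF) hu.1.le
  linarith

end Multinomial

end ConvCloseness

end

theorem theorem2 :
    -- the smallest constants `u_ℓ` exist in `(0,∞)` and are bounded as claimed
    ((∀ l : ℕ, IsLeast (ConvCloseness.admissible.{v} l) (ConvCloseness.uConst.{v} l) ∧
        ∃ x : ℝ, 0 < x ∧ x < 1 ∧ x ^ (l + 1) + x / 2 = 1 ∧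
          (∀ y : ℝ, 0 < y → y ^ (l + 1) + y / 2 = 1 → y = x) ∧
          ConvCloseness.uConst.{v} l ≤
            (2 * Real.exp 1 * ConvCloseness.c₁) ^ (((l : ℝ) + 1) / 2) / (1 - x)) ∧
      ConvCloseness.uConst.{v} 0 ≤ 5.9 ∧ ConvCloseness.uConst.{v} 1 ≤ 17.3 ∧
      ConvCloseness.uConst.{v} 2 ≤ 44.5 ∧ ConvCloseness.uConst.{v} 3 ≤ 107.5) ∧
    -- the smallest constants in the case `G = F̄`
    ((∀ l : ℕ, 1 ≤ l →
        IsLeast (ConvCloseness.admissibleMean.{v} l) (ConvCloseness.uTilde.{v} l)) ∧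
      ConvCloseness.uTilde.{v} 1 ≤ 10.94 ∧ ConvCloseness.uTilde.{v} 2 ≤ 31.5 ∧
      ConvCloseness.uTilde.{v} 3 ≤ 82.2 ∧
      ∀ l : ℕ, 1 ≤ l →
        ∃ x : ℝ, 0 < x ∧ x < 1 ∧ x ^ (l + 1) - x ^ 2 / 2 + x = 1 ∧
          (∀ y : ℝ, 0 < y → y ^ (l + 1) - y ^ 2 / 2 + y = 1 → y = x) ∧
          ConvCloseness.uTilde.{v} l ≤
            (2 * Real.exp 1 * ConvCloseness.c₁) ^ (((l : ℝ) + 1) / 2) / (1 - x)) ∧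
    -- the consequence for the multinomial approximation, with a constant free of the dimension `d`
    (∀ (X : Type v) [AddCommGroup X] [MeasurableSpace X] [MeasurableSub₂ X] (n d : ℕ),
      1 ≤ n → 1 ≤ d →
      ∀ (H : Fin (d + 1) → MeasureTheory.ProbabilityMeasure X)
        (F : Fin n → MeasureTheory.ProbabilityMeasure X)
        (p : Fin n → Fin (d + 1) → ℝ) (pbar : Fin (d + 1) → ℝ),
        (∀ j r, 0 ≤ p j r ∧ p j r ≤ 1) → (∀ j, ∑ r, p j r = 1) →
        (∀ r, pbar r = (n : ℝ)⁻¹ * ∑ j, p j r) → (∀ r, 0 < pbar r) →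
        (∀ j, ConvCloseness.sm (F j) = ∑ r, p j r • ConvCloseness.sm (H r)) →
        ConvCloseness.tvNorm
            ((∏ j, ConvCloseness.sm (F j)) - ConvCloseness.meanF F ^ n) ≤
          2 * ConvCloseness.uTilde.{v} 1 *
            ∑ r : Fin d, ∑ j, (pbar r.succ - p j r.succ) ^ 2 / (n * pbar r.succ * pbar 0) ∧
        ConvCloseness.tvNorm
            ((∏ j, ConvCloseness.sm (F j)) - ConvCloseness.meanF F ^ n) ≤
          21.88 *
            ∑ r : Fin d, ∑ j, (pbar r.succ - p j r.succ) ^ 2 / (n * pbar r.succ * pbar 0)) := by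
  refine ⟨⟨fun l => ?_, ConvCloseness.uConst_zero_le, ConvCloseness.uConst_one_le,
    ConvCloseness.uConst_two_le, ConvCloseness.uConst_three_le⟩, ⟨fun l hl => ?_,
    ConvCloseness.uTilde_one_le, ConvCloseness.uTilde_two_le, ConvCloseness.uTilde_three_le,
    fun l hl => ?_⟩, ?_⟩
  · obtain ⟨x, hx, hx1, hxl, hu⟩ := ConvCloseness.exists_unique_root_linear l
    have hm := ConvCloseness.mem_admissible.{v} hx hx1 hxl
    exact ⟨ConvCloseness.isLeast_admissible ⟨_, hm⟩, x, hx, hx1, hxl, hu,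
      ConvCloseness.uConst_le hm⟩
  · obtain ⟨x, hx, hx1, hxl, -⟩ := ConvCloseness.exists_unique_root_quadratic hl
    exact ConvCloseness.isLeast_admissibleMean hl
      ⟨_, ConvCloseness.mem_admissibleMean.{v} hl hx hx1 hxl⟩
  · obtain ⟨x, hx, hx1, hxl, hu⟩ := ConvCloseness.exists_unique_root_quadratic hl
    exact ⟨x, hx, hx1, hxl, hu,
      ConvCloseness.uTilde_le (ConvCloseness.mem_admissibleMean.{v} hl hx hx1 hxl)⟩
  · intro X _ _ _ n d hn _ H F p pbar _ hp1 hpbar hpos hF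
    obtain ⟨x, hx, hx1, hxl, -⟩ := ConvCloseness.exists_unique_root_quadratic (le_refl 1)
    have hmin := ConvCloseness.isLeast_admissibleMean (le_refl 1)
      ⟨_, ConvCloseness.mem_admissibleMean.{v} (le_refl 1) hx hx1 hxl⟩
    have h := ConvCloseness.tvNorm_prod_sub_meanF_pow_le hmin.1 hn hp1 hpbar hpos hF
    refine ⟨h, h.trans (mul_le_mul_of_nonneg_right ?_ ?_)⟩
    · linarith [ConvCloseness.uTilde_one_le.{v}]
    · exact Finset.sum_nonneg fun r _ => Finset.sum_nonneg fun j _ => div_nonneg (sq_nonneg _)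
        (mul_nonneg (mul_nonneg (Nat.cast_nonneg n) (hpos _).le) (hpos _).le)
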